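/- Let $r$ be an odd prime and $s\ge 0$ an integer such that $p=2^s r+1$ is prime, $2$ is a primitive root modulo $r$, and $r\ge\sqrt p+1$. Let $m>1$ be an integer, $\omega$ a primitive element of $\mathbb F_{p^m}$, $\nu=(p^m-1)/(p-1)$ and $g=\omega^{\nu}$, a primitive element of $\mathbb F_p$. Let $D_0=\{g^{2i}: 0\le i<(p-1)/2\}$ and $D_1=gD_0$ be the cyclotomic classes of order $2$ in $\mathbb F_p$. For $A\in\mathbb F_p$ define $\rho_A:\mathbb F_p\to\mathbb F_2$ by $\rho_A(x)=0$ if $x+A=0$ and $\rho_A(x)=k$ if $x+A\in D_k$ ($k=0,1$). Consider the sequences over $\mathbb F_2$ $$t_{A,n}=\rho_A(g^n),\qquad T_{A,n}=\rho_A\bigl(\mathrm{Tr}_{\mathbb F_{p^m}/\mathbb F_p}(\omega^n)\bigr),\qquad n\ge 0.$$ For a periodic sequence $S=(S_n)_{n\ge0}$ over $\mathbb F_2$, the linear complexity $L(S)$ is the least $L$ for which there are $a_0,\dots,a_{L-1}\in\mathbb F_2$ with $S_{n+L}=a_{L-1}S_{n+L-1}+\cdots+a_0S_n$ for all $n\ge0$,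 and the minimal polynomial of $S$ is the polynomial $m_S(x)=x^L-a_{L-1}x^{L-1}-\cdots-a_0\in\mathbb F_2[x]$ belonging to this (unique) shortest recurrence. Let $(A/p)$ denote the Legendre symbol. 1. If $A=1$ and $s=1$, or if $(A/p)=-1$ and $s\ge2$, then $$m_{t_A}(x)=x^{p-1}+1,\quad m_{T_A}(x)=x^{p^m-1}+1,\quad L(t_A)=p-1,\quad L(T_A)=p^m-1.$$ 2. If $(A/p)=-1$, $m$ is odd and $p\equiv 7 \pmod 8$, then $$m_{t_A}(x)=\frac{x^{p-1}+1}{x+1},\quad m_{T_A}(x)=\frac{(x+1)(x^{p^m-1}+1)}{x^{2\nu}+1},\quad L(t_A)=p-2,\quad L(T_A)=\frac{p^{m+1}-3p^m+2}{p-1}.$$ -/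

import Mathlib

/-- The linear complexity of a sequence `S` over `K`: the least order `L` of a linear recurrence
`S (n + L) = a (L-1) * S (n + L - 1) + ⋯ + a 0 * S n` satisfied for all `n ≥ 0`. -/
noncomputable def linearComplexity {K : Type*} [CommRing K] (S : ℕ → K) : ℕ :=
  sInf {L : ℕ | ∃ E : LinearRecurrence K, E.IsSolution S ∧ E.order = L}

/-- `P` is a minimal polynomial of `S`: it is the characteristic polynomial
`X ^ L - a (L-1) X ^ (L-1) - ⋯ - a 0` of a shortest linear recurrence satisfied by `S`. -/
def IsMinimalPolynomial {K : Type*} [CommRing K] (S : ℕ → K) (P : Polynomial K) : Prop :=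
  ∃ E : LinearRecurrence K, E.IsSolution S ∧ E.order = linearComplexity S ∧ E.charPoly = P

/-- The cyclotomic class `D_j = {g ^ j * g ^ (i d) | 0 ≤ i < (p - 1) / d}` of order `d` in `𝔽_p`,
where `d ∣ p - 1` and `g` is a primitive element of `𝔽_p`. -/
def cyclotomicClass {p : ℕ} (g : ZMod p) (d j : ℕ) : Set (ZMod p) :=
  {x | ∃ i : ℕ, i < (p - 1) / d ∧ x = g ^ j * g ^ (i * d)}

/-- The map `ρ_A : 𝔽_p → 𝔽_ℓ` with `ρ_A x = 0` if `x + A = 0`, and `ρ_A x = k` if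
`x + A ∈ D_k`, `0 ≤ k ≤ ℓ - 1`. As the cyclotomic classes of order `ℓ` partition the nonzero
elements, the set below is `{k}` in the second case. -/
noncomputable def ntuMap {p : ℕ} (ℓ : ℕ) (g A x : ZMod p) : ZMod ℓ :=
  if x + A = 0 then 0
  else ((sInf {k : ℕ | k < ℓ ∧ x + A ∈ cyclotomicClass g ℓ k} : ℕ) : ZMod ℓ)

/-- The `ℓ`-ary generalized NTU sequence `T_A`: `T_{A,n} = ρ_A (Tr (ω ^ n))`. -/
noncomputable def ntuSeq {p : ℕ} (ℓ : ℕ) {F : Type*} [Field F] [Algebra (ZMod p) F]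
    (g A : ZMod p) (ω : F) (n : ℕ) : ZMod ℓ :=
  ntuMap ℓ g A (Algebra.trace (ZMod p) F (ω ^ n))

/-- The sequence `t_A`: `t_{A,n} = ρ_A (g ^ n)`. -/
noncomputable def ntuShortSeq {p : ℕ} (ℓ : ℕ) (g A : ZMod p) (n : ℕ) : ZMod ℓ :=
  ntuMap ℓ g A (g ^ n)

/-! Let `N = p ^ m - 1` and let `G` be the reversed generating polynomial of one period. A
polynomial `P` annihilates the sequence iff `X ^ N - 1` divides `P * G`, so the minimal polynomial
is `(X ^ N - 1) / gcd(X ^ N - 1, G)`. What is needed is which `N`-th roots of unity `θ` over `𝔽_2`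
are roots of `G`, and with what multiplicity.

Let `χ` be the character of `F` with `χ ω = θ⁻¹`. Then `G(θ) = ∑ ρ_A(Tr x) χ x`, and summing over
the fibres of the trace gives `G(θ) = (∑ ρ_A(g^n) y^n) * U` with `y = θ⁻¹ ^ ν`. The factor `U`, the
sum of `χ` over trace one, is nonzero because it divides a Gauss sum
(`exists_aeval_revGenPoly_ntuSeq`).

If `y ≠ 1`, the short sum does not vanish (`sum_ntuMap_mul_pow_ne_zero`). As `Φ_r` is irreducible
over `𝔽_2`, vanishing would make the quadratic character constant on `A^(2^s) - z` for `z ≠ A^(2^s)`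
in the subgroup of order `r`. A second moment bound then gives `(r - 1)^2 ≤ p - r`, against `r ≥ √p
+ 1`. If `y = 1`, the short sum is the parity of `(p - 1) / 2`, corrected by the class of `A`: it is
`1` in the first case, so `G` has no root among the `N`-th roots of unity.

In the second case it is `0`, so the common roots are the `ν`-th roots of unity, each double in `X ^
N - 1`. The derivative of `G` there is a sum over nonsquares of `F`. Parity counts for `p ≡ 7 (mod
8)` show that it vanishes except at `θ = 1`, so the gcd is `(X ^ (2ν) - 1) / (X - 1)`.

The sequence `t_A` is the instance `F = 𝔽_p`, `ω = g`, `ν = 1`. -/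

section
open Polynomial Finset

/-! ### Annihilators of a sequence and minimal polynomials. -/

/-- The shift operator on sequences. -/
def seqShift (K : Type*) [CommRing K] : Module.End K (ℕ → K) where
  toFun S n := S (n + 1)
  map_add' _ _ := rfl
  map_smul' _ _ := rfl

theorem seqShift_pow_apply {K : Type*} [CommRing K] (j : ℕ) (S : ℕ → K) (n : ℕ) :
    (seqShift K ^ j) S n = S (n + j) := by
  induction j generalizing n with
  | zero => simp
  | succ j ih =>
    rw [pow_succ', Module.End.mul_apply]
    change ((seqShift K ^ j) S) (n + 1) = _
    rw [ih]; congr 1; ring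

theorem isSolution_iff_aeval_charPoly {K : Type*} [CommRing K] (E : LinearRecurrence K)
    (S : ℕ → K) : E.IsSolution S ↔ aeval (seqShift K) E.charPoly S = 0 := by
  rw [funext_iff]
  refine forall_congr' fun n => ?_
  simp [LinearRecurrence.charPoly, aeval_monomial, seqShift_pow_apply, sub_eq_zero]

theorem exists_charPoly_eq {K : Type*} [CommRing K] [Nontrivial K] {P : K[X]} (hP : P.Monic) :
    ∃ E : LinearRecurrence K, E.order = P.natDegree ∧ E.charPoly = P := by
  refine ⟨⟨P.natDegree, fun i => -P.coeff i⟩, rfl, ?_⟩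
  conv_rhs => rw [hP.as_sum]
  simp only [LinearRecurrence.charPoly, map_neg, sum_neg_distrib, sub_neg_eq_add,
    ← C_mul_X_pow_eq_monomial, map_one, one_mul]
  rw [Fin.sum_univ_eq_sum_range (fun i => C (P.coeff i) * X ^ i)]

theorem minimalPolynomial_of_annihilator {K : Type*} [Field K] {S : ℕ → K} {M : K[X]}
    (hM : M.Monic) (h : ∀ P : K[X], aeval (seqShift K) P S = 0 ↔ M ∣ P) :
    (∀ P : K[X], IsMinimalPolynomial S P ↔ P = M) ∧ linearComplexity S = M.natDegree := by
  have hdeg : ∀ E : LinearRecurrence K, E.charPoly.natDegree = E.order := fun E =>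
    natDegree_eq_of_degree_eq_some E.charPoly_degree_eq_order
  obtain ⟨E, hE, hEM⟩ := exists_charPoly_eq hM
  have hEs : E.IsSolution S := by rw [isSolution_iff_aeval_charPoly, h, hEM]
  have hL : linearComplexity S = M.natDegree := by
    refine le_antisymm (Nat.sInf_le ⟨E, hEs, hE⟩) (le_csInf ⟨_, E, hEs, hE⟩ ?_)
    rintro _ ⟨E', hs, rfl⟩
    rw [isSolution_iff_aeval_charPoly, h] at hs
    rw [← hdeg]
    exact natDegree_le_of_dvd hs E'.charPoly_monic.ne_zero
  refine ⟨fun P => ⟨?_, ?_⟩, hL⟩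
  · rintro ⟨E', hs, ho, rfl⟩
    rw [isSolution_iff_aeval_charPoly, h] at hs
    refine (eq_of_monic_of_dvd_of_natDegree_le hM E'.charPoly_monic hs ?_)
    rw [hdeg, ho, hL]
  · rintro rfl
    exact ⟨E, hEs, hE.trans hL.symm, hEM⟩

/-! ### The generating polynomial of a periodic sequence. -/

/-- The reversed generating polynomial of one period of a sequence. -/
noncomputable def revGenPoly {K : Type*} [CommRing K] (N : ℕ) (S : ℕ → K) : K[X] :=
  ∑ n ∈ range N, C (S n) * X ^ (N - n)

/-- Because the exponents are reversed, multiplication by `X` is the shift modulo `X ^ N - 1`. -/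
theorem X_mul_revGenPoly {K : Type*} [CommRing K] {N : ℕ} {S : ℕ → K}
    (hS : S N = S 0) :
    X * revGenPoly N S = revGenPoly N (seqShift K S) + C (S 0) * X * (X ^ N - 1) := by
  have h1 : X * revGenPoly N S = ∑ n ∈ range N, C (S n) * X ^ (N + 1 - n) := by
    rw [revGenPoly, mul_sum]
    refine sum_congr rfl fun n hn => ?_
    rw [show N + 1 - n = N - n + 1 by have := mem_range.1 hn; omega, pow_succ]; ring
  have h2 : revGenPoly N (seqShift K S) = ∑ n ∈ range N, C (S (n + 1)) * X ^ (N + 1 - (n + 1)) := by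
    rw [revGenPoly]
    refine sum_congr rfl fun n _ => ?_
    rw [Nat.add_sub_add_right]; rfl
  have h3 := sum_range_succ (fun n => C (S n) * (X : K[X]) ^ (N + 1 - n)) N
  have h4 := sum_range_succ' (fun n => C (S n) * (X : K[X]) ^ (N + 1 - n)) N
  rw [h1, h2]
  rw [h3] at h4
  simp only [Nat.add_sub_cancel_left, Nat.sub_zero, hS] at h4
  linear_combination h4

theorem revGenPoly_add {K : Type*} [CommRing K] (N : ℕ) (S T : ℕ → K) :
    revGenPoly N (S + T) = revGenPoly N S + revGenPoly N T := by
  simp [revGenPoly, add_mul, sum_add_distrib]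

theorem revGenPoly_smul {K : Type*} [CommRing K] (N : ℕ) (a : K) (S : ℕ → K) :
    revGenPoly N (a • S) = C a * revGenPoly N S := by
  simp [revGenPoly, mul_sum, mul_assoc]

theorem aeval_seqShift_periodic {K : Type*} [CommRing K] {N : ℕ} {S : ℕ → K}
    (hS : ∀ n, S (n + N) = S n) (P : K[X]) (n : ℕ) :
    aeval (seqShift K) P S (n + N) = aeval (seqShift K) P S n := by
  induction P using Polynomial.induction_on' with
  | add p q hp hq => simp [hp, hq]
  | monomial k a =>
    simp [aeval_monomial, seqShift_pow_apply, add_right_comm n N k, hS]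

theorem dvd_mul_revGenPoly_sub {K : Type*} [CommRing K] {N : ℕ} {S : ℕ → K}
    (hS : ∀ n, S (n + N) = S n) (P : K[X]) :
    X ^ N - 1 ∣ P * revGenPoly N S - revGenPoly N (aeval (seqShift K) P S) := by
  induction P using Polynomial.induction_on with
  | C a => simp [Polynomial.aeval_C, Module.algebraMap_end_apply, revGenPoly_smul]
  | add p q hp hq =>
    have := dvd_add hp hq
    rw [map_add, LinearMap.add_apply, revGenPoly_add]
    convert this using 1; ring
  | monomial n a ih =>
    have h := X_mul_revGenPoly (N := N) (S := aeval (seqShift K) (C a * X ^ n) S)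
      (by have := aeval_seqShift_periodic hS (C a * X ^ n) 0; rwa [zero_add] at this)
    have e : aeval (seqShift K) (C a * X ^ (n + 1)) S
        = seqShift K (aeval (seqShift K) (C a * X ^ n) S) := by
      rw [show (C a * X ^ (n + 1) : K[X]) = X * (C a * X ^ n) by ring, map_mul, aeval_X,
        Module.End.mul_apply]
    rw [e]
    obtain ⟨c, hc⟩ := ih
    refine ⟨X * c + C (aeval (seqShift K) (C a * X ^ n) S 0) * X, ?_⟩
    linear_combination (X : K[X]) * hc + h

theorem revGenPoly_dvd_iff {K : Type*} [Field K] {N : ℕ} (hN : 0 < N) {S : ℕ → K}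
    (hS : ∀ n, S (n + N) = S n) : X ^ N - 1 ∣ revGenPoly N S ↔ S = 0 := by
  constructor
  · intro h
    -- The exponents run from `1` to `N`; removing the factor `X`, a unit modulo `X ^ N - 1`, brings
    -- the degree below `N`.
    have hX : revGenPoly N S = (∑ n ∈ range N, C (S n) * X ^ (N - 1 - n)) * X := by
      rw [revGenPoly, sum_mul]
      refine sum_congr rfl fun n hn => ?_
      rw [show N - n = N - 1 - n + 1 by have := mem_range.1 hn; omega, pow_succ, mul_assoc]
    have hc : IsCoprime (X ^ N - 1 : K[X]) X :=
      ⟨-1, X ^ (N - 1), by rw [← pow_succ, Nat.sub_add_cancel hN]; ring⟩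
    rw [hX] at h
    have h0 := hc.dvd_of_dvd_mul_right h
    have hz := eq_zero_of_dvd_of_degree_lt h0 (by
      rw [show (X ^ N - 1 : K[X]) = X ^ N - C 1 by simp, degree_X_pow_sub_C hN]
      refine (degree_lt_iff_coeff_zero _ _).2 fun k hk => ?_
      simp only [finsetSum_coeff, coeff_C_mul, coeff_X_pow]
      refine sum_eq_zero fun n hn => ?_
      rw [if_neg (by omega), mul_zero])
    have hlt : ∀ n < N, S n = 0 := by
      intro n hn
      have := congrArg (fun q => coeff q (N - 1 - n)) hz
      simp only [finsetSum_coeff, coeff_C_mul, coeff_X_pow, coeff_zero] at this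
      rw [sum_eq_single_of_mem n (mem_range.2 hn)] at this
      · simpa using this
      · intro b hb hbn
        have := mem_range.1 hb
        rw [if_neg (by omega), mul_zero]
    have hp : Function.Periodic S N := hS
    ext n
    rw [← hp.map_mod_nat n]
    exact hlt _ (Nat.mod_lt _ hN)
  · rintro rfl
    simp [revGenPoly]

theorem aeval_seqShift_eq_zero_iff {K : Type*} [Field K] {N : ℕ} (hN : 0 < N) {S : ℕ → K}
    (hS : ∀ n, S (n + N) = S n) (P : K[X]) :
    aeval (seqShift K) P S = 0 ↔ X ^ N - 1 ∣ P * revGenPoly N S := by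
  rw [← revGenPoly_dvd_iff hN (aeval_seqShift_periodic hS P)]
  exact (dvd_iff_dvd_of_dvd_sub (dvd_mul_revGenPoly_sub hS P)).symm

/-- If `X ^ N - 1 = M * D` and the reversed generating polynomial is `D * H` with `H` coprime to
`M`, then `M` is the minimal polynomial. -/
theorem minimalPolynomial_of_factor {K : Type*} [Field K] {N : ℕ} (hN : 0 < N) {S : ℕ → K}
    (hS : ∀ n, S (n + N) = S n) {M D H : K[X]} (hM : M.Monic) (hD : D ≠ 0)
    (hMD : X ^ N - 1 = M * D) (hH : revGenPoly N S = D * H) (hc : IsCoprime M H) :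
    (∀ P : K[X], IsMinimalPolynomial S P ↔ P = M) ∧ linearComplexity S = M.natDegree := by
  refine minimalPolynomial_of_annihilator hM fun P => ?_
  rw [aeval_seqShift_eq_zero_iff hN hS, hMD, hH, mul_left_comm P, mul_comm M,
    mul_dvd_mul_iff_left hD]
  exact ⟨hc.dvd_of_dvd_mul_right, fun h => h.mul_right _⟩

theorem isCoprime_of_no_common_root {K : Type*} (L : Type*) [Field K] [Field L] [Algebra K L]
    [IsAlgClosed L] {P Q : K[X]} (h : ∀ θ : L, aeval θ P = 0 → aeval θ Q = 0 → False) :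
    IsCoprime P Q :=
  isCoprime_of_irreducible_dvd (fun ⟨h1, h2⟩ => h 0 (by simp [h1]) (by simp [h2]))
    fun z hz h1 h2 => by
      obtain ⟨θ, hθ⟩ := IsAlgClosed.exists_aeval_eq_zero L z
        (fun h0 => hz.not_isUnit (isUnit_iff_degree_eq_zero.2 h0))
      exact h θ (aeval_eq_zero_of_dvd_aeval_eq_zero h1 hθ)
        (aeval_eq_zero_of_dvd_aeval_eq_zero h2 hθ)

/-! ### Primitive elements and quadratic character sums. -/

theorem exists_pow_eq_of_isPrimitiveRoot {F : Type*} [Field F] [Fintype F] {ω : F}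
    (hω : IsPrimitiveRoot ω (Fintype.card F - 1)) {x : F} (hx : x ≠ 0) :
    ∃ i < Fintype.card F - 1, ω ^ i = x := by
  have : NeZero (Fintype.card F - 1) :=
    ⟨by have := Fintype.one_lt_card (α := F); omega⟩
  exact hω.eq_pow_of_pow_eq_one (FiniteField.pow_card_sub_one_eq_one x hx)

theorem sum_eq_sum_range_pow {F M : Type*} [Field F] [Fintype F] [AddCommMonoid M] {ω : F}
    (hω : IsPrimitiveRoot ω (Fintype.card F - 1)) (f : F → M) (h0 : f 0 = 0) :
    ∑ x, f x = ∑ n ∈ range (Fintype.card F - 1), f (ω ^ n) := by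
  have hc := Fintype.one_lt_card (α := F)
  have hne : ω ≠ 0 := hω.ne_zero (by omega)
  symm
  refine Finset.sum_of_injOn (fun n => ω ^ n) ?_ (fun _ _ => mem_coe.2 (mem_univ _)) ?_
    (fun _ _ => rfl)
  · intro a ha b hb h
    exact hω.pow_inj (by simpa using ha) (by simpa using hb) h
  · intro x _ hx
    rcases eq_or_ne x 0 with rfl | h
    · exact h0
    · obtain ⟨i, hi, rfl⟩ := exists_pow_eq_of_isPrimitiveRoot hω h
      exact absurd ⟨i, by simpa using hi, rfl⟩ hx

theorem quadraticChar_primitiveRoot {F : Type*} [Field F] [Fintype F] [DecidableEq F] {ω : F}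
    (hF : ringChar F ≠ 2) (hω : IsPrimitiveRoot ω (Fintype.card F - 1)) :
    quadraticChar F ω = -1 := by
  have hc := Fintype.one_lt_card (α := F)
  rcases quadraticChar_dichotomy (hω.ne_zero (by omega)) with h | h
  · obtain ⟨a, ha⟩ := quadraticChar_exists_neg_one hF
    obtain ⟨i, -, rfl⟩ := exists_pow_eq_of_isPrimitiveRoot hω (x := a)
      (by rintro rfl; simp at ha)
    rw [map_pow, h, one_pow] at ha
    norm_num at ha
  · exact h

theorem quadraticChar_primitiveRoot_pow {F : Type*} [Field F] [Fintype F] [DecidableEq F] {ω : F}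
    (hF : ringChar F ≠ 2) (hω : IsPrimitiveRoot ω (Fintype.card F - 1)) (n : ℕ) :
    quadraticChar F (ω ^ n) = -1 ↔ Odd n := by
  rw [map_pow, quadraticChar_primitiveRoot hF hω]
  rcases Nat.even_or_odd n with h | h
  · simp [h.neg_one_pow, Nat.not_odd_iff_even.2 h]
  · simp [h.neg_one_pow, h]

/-- The substitution `x = z + (w - z) u` turns this into the Jacobi sum of the quadratic character
with its inverse. -/
theorem sum_quadraticChar_sub_mul_sub {F : Type*} [Field F] [Fintype F] [DecidableEq F]
    (hF : ringChar F ≠ 2) {z w : F} (h : z ≠ w) :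
    ∑ x, quadraticChar F (x - z) * quadraticChar F (x - w) = -1 := by
  have hd : w - z ≠ 0 := sub_ne_zero.2 h.symm
  have hJ := jacobiSum_nontrivial_inv (quadraticChar_ne_one hF)
  rw [(quadraticChar_isQuadratic F).inv, jacobiSum] at hJ
  rw [← ((Equiv.mulLeft₀ (w - z) hd).trans (Equiv.addLeft z)).sum_comp]
  have : ∀ u : F, quadraticChar F (z + (w - z) * u - z) * quadraticChar F (z + (w - z) * u - w)
      = quadraticChar F (-1) * (quadraticChar F u * quadraticChar F (1 - u)) := by
    intro u
    rw [show z + (w - z) * u - z = (w - z) * u by ring,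
      show z + (w - z) * u - w = (w - z) * (-1 * (1 - u)) by ring]
    simp only [map_mul]
    linear_combination (quadraticChar F u * quadraticChar F (-1) * quadraticChar F (1 - u)) *
      quadraticChar_sq_one hd
  simp only [Equiv.trans_apply, Equiv.mulLeft₀_apply, Equiv.coe_addLeft, this]
  rw [← mul_sum, hJ, mul_neg, ← sq, quadraticChar_sq_one (by simp)]

/-- On expanding the square, each diagonal pair contributes `card F - 1` and each off-diagonal pair
`-1`. -/
theorem sum_sq_sum_quadraticChar_sub {F : Type*} [Field F] [Fintype F] [DecidableEq F]
    (hF : ringChar F ≠ 2) (K : Finset F) :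
    ∑ x, (∑ z ∈ K, quadraticChar F (x - z)) ^ 2 = #K * ((Fintype.card F : ℤ) - #K) := by
  have h1 : ∀ z w : F, ∑ x, quadraticChar F (x - z) * quadraticChar F (x - w)
      = (if z = w then (Fintype.card F : ℤ) else 0) - 1 := by
    intro z w
    split_ifs with h
    · subst h
      have : ∀ x, quadraticChar F (x - z) * quadraticChar F (x - z)
          = 1 - if x = z then 1 else 0 := by
        intro x
        split_ifs with hx
        · simp [hx]
        · rw [← sq, quadraticChar_sq_one (sub_ne_zero.2 hx)]; simp
      rw [sum_congr rfl fun x _ => this x]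
      simp [sum_sub_distrib]
    · rw [sum_quadraticChar_sub_mul_sub hF h]; simp
  simp_rw [sq, sum_mul_sum]
  rw [sum_comm]
  simp_rw [sum_comm (s := univ), h1]
  simp [sum_sub_distrib, sum_ite_eq]
  ring

/-- A multiplicative subgroup on which the quadratic character of `a - z` is constant is small. -/
theorem sq_card_sub_one_le {F : Type*} [Field F] [Fintype F] [DecidableEq F]
    (hF : ringChar F ≠ 2) {r : ℕ} (hr : 0 < r) {κ a : F} (hκ : IsPrimitiveRoot κ r)
    (ha : a ^ r = 1) {ε : ℤ} (hε : ∀ z : F, z ^ r = 1 → z ≠ a → quadraticChar F (a - z) = ε) :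
    ((r : ℤ) - 1) ^ 2 * ε ^ 2 ≤ Fintype.card F - r := by
  set K := nthRootsFinset r (1 : F) with hK
  have hmem : ∀ z, z ∈ K ↔ z ^ r = 1 := fun z => mem_nthRootsFinset hr 1
  have hcard : #K = r := hκ.card_nthRootsFinset
  set f : F → ℤ := fun x => ∑ z ∈ K, quadraticChar F (x - z) with hf
  have hne : ∀ b ∈ K, b ≠ 0 := by
    rintro b hb rfl
    rw [hmem, zero_pow hr.ne'] at hb
    exact zero_ne_one hb
  -- Scaling by `b` permutes the subgroup `K`, so `f b` and `f 1` differ by a sign.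
  have hinv : ∀ b ∈ K, f b ^ 2 = f 1 ^ 2 := by
    intro b hb
    have : f b = quadraticChar F b * f 1 := by
      rw [hf]
      simp only [mul_sum]
      refine (sum_nbij' (fun z => b * z) (fun z => b⁻¹ * z) ?_ ?_ ?_ ?_ ?_).symm
      · intro z hz
        rw [hmem] at hb hz ⊢
        rw [mul_pow, hb, hz, one_mul]
      · intro z hz
        rw [hmem] at hb hz ⊢
        rw [mul_pow, inv_pow, hb, hz, inv_one, one_mul]
      · intro z _; exact inv_mul_cancel_left₀ (hne b hb) z
      · intro z _; exact mul_inv_cancel_left₀ (hne b hb) z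
      · intro z _
        rw [← map_mul]; congr 1; ring
    rw [this, mul_pow, quadraticChar_sq_one (hne b hb), one_mul]
  have haK : a ∈ K := (hmem a).2 ha
  have hfa : f a = (r - 1) * ε := by
    rw [hf]
    simp only
    rw [← add_sum_erase _ _ haK, sub_self, quadraticChar_zero, zero_add,
      sum_congr rfl (g := fun _ => ε), sum_const, card_erase_of_mem haK, hcard, nsmul_eq_mul,
      Nat.cast_pred hr]
    intro z hz
    rw [mem_erase, hmem] at hz
    exact hε z hz.2 hz.1
  -- Only the `r` points of `K` are kept in the second moment.
  have hsum : (r : ℤ) * f a ^ 2 ≤ r * (Fintype.card F - r) := by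
    have h1 := sum_sq_sum_quadraticChar_sub hF K
    rw [hcard] at h1
    rw [← h1]
    calc (r : ℤ) * f a ^ 2 = ∑ b ∈ K, f b ^ 2 := by
          rw [sum_congr rfl (g := fun _ => f a ^ 2), sum_const, hcard, nsmul_eq_mul]
          intro b hb
          rw [hinv b hb, hinv a haK]
      _ ≤ _ := sum_le_sum_of_subset_of_nonneg (subset_univ _) fun _ _ _ => sq_nonneg _
  have := le_of_mul_le_mul_left hsum (by exact_mod_cast hr)
  rwa [hfa, mul_pow] at this

/-! ### Nonvanishing of the short sum at `y ≠ 1`. -/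

theorem prod_range_sub_pow_mul {R : Type*} [CommRing R] [IsDomain R] {n : ℕ} (hn : 0 < n) {ζ : R}
    (hζ : IsPrimitiveRoot ζ n) (x y : R) :
    ∏ k ∈ range n, (x - ζ ^ k * y) = x ^ n - y ^ n := by
  classical
  rw [hζ.pow_sub_pow_eq_prod_sub_mul x y hn]
  refine prod_nbij (fun k => ζ ^ k) ?_ ?_ ?_ (fun _ _ => rfl)
  · intro k _
    rw [mem_nthRootsFinset hn, ← pow_mul, mul_comm, pow_mul, hζ.pow_eq_one, one_pow]
  · intro a ha b hb h
    exact hζ.pow_inj (by simpa using ha) (by simpa using hb) h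
  · intro z hz
    have : NeZero n := ⟨hn.ne'⟩
    obtain ⟨i, hi, rfl⟩ := hζ.eq_pow_of_pow_eq_one ((mem_nthRootsFinset hn 1).1 hz)
    exact ⟨i, by simpa using hi, rfl⟩

/-- The isomorphism of `{1, -1}` with `𝔽_2`: it turns a sum of sequence values into the quadratic
character of a product. -/
theorem sum_ite_neg_one {ι : Type*} (s : Finset ι) (u : ι → ℤ)
    (hu : ∀ i ∈ s, u i = 1 ∨ u i = -1) :
    (∑ i ∈ s, if u i = -1 then (1 : ZMod 2) else 0) = (if ∏ i ∈ s, u i = -1 then 1 else 0) ∧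
      (∏ i ∈ s, u i = 1 ∨ ∏ i ∈ s, u i = -1) := by
  classical
  induction s using Finset.induction_on with
  | empty => simp
  | insert a s ha ih =>
    obtain ⟨h1, h2⟩ := ih fun i hi => hu i (mem_insert_of_mem hi)
    rw [sum_insert ha, prod_insert ha, h1]
    rcases hu a (mem_insert_self a s) with h | h <;> rcases h2 with h' | h' <;>
      simp [h, h']
    decide

theorem sum_range_mul_eq {M : Type*} [AddCommMonoid M] (n r : ℕ) (f : ℕ → M) :
    ∑ i ∈ range (n * r), f i = ∑ j ∈ range r, ∑ k ∈ range n, f (j + r * k) := by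
  induction n with
  | zero => simp
  | succ n ih =>
    rw [Nat.succ_mul, sum_range_add, ih, ← sum_add_distrib]
    refine sum_congr rfl fun j _ => ?_
    rw [sum_range_succ, add_comm (n * r) j, mul_comm n r]

/-- Irreducible factors of `Φ_r` have degree the order of `2` modulo `r`, here `r - 1`. -/
theorem irreducible_cyclotomic_zmod_two {r : ℕ} (hr : r.Prime) (hr2 : Odd r)
    (h2 : IsPrimitiveRoot (2 : ZMod r) (r - 1)) : Irreducible (cyclotomic r (ZMod 2)) := by
  have hn : ¬ 2 ∣ r := fun h => Nat.not_even_iff_odd.2 hr2 (even_iff_two_dvd.2 h)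
  refine ZMod.irreducible_of_dvd_cyclotomic_of_natDegree hn dvd_rfl ?_
  rw [natDegree_cyclotomic, Nat.totient_prime hr, ← orderOf_units, ZMod.coe_unitOfCoprime,
    h2.eq_orderOf]
  rfl

theorem coeff_eq_of_sum_pow_eq_zero {r : ℕ} (hr : r.Prime)
    (hirr : Irreducible (cyclotomic r (ZMod 2))) {L : Type*} [Field L] [Algebra (ZMod 2) L] {y : L}
    (hy : y ^ r = 1) (hy1 : y ≠ 1) (c : ℕ → ZMod 2)
    (h : ∑ j ∈ range r, algebraMap (ZMod 2) L (c j) * y ^ j = 0) :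
    ∀ j < r, c j = c (r - 1) := by
  have hr0 := hr.pos
  have hcyc : cyclotomic r (ZMod 2) = ∑ i ∈ range r, X ^ i := by
    have := Fact.mk hr
    exact cyclotomic_prime _ r
  have hroot : aeval y (cyclotomic r (ZMod 2)) = 0 := by
    have h1 : (∑ i ∈ range r, y ^ i) * (y - 1) = 0 := by rw [geom_sum_mul, hy, sub_self]
    rw [hcyc]
    simpa using (mul_eq_zero.1 h1).resolve_right (sub_ne_zero.2 hy1)
  -- Subtracting `c (r - 1) * Φ_r` kills the top coefficient, leaving a multiple of `Φ_r` of smaller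
  -- degree.
  have hdvd : cyclotomic r (ZMod 2) ∣ ∑ j ∈ range r, C (c j - c (r - 1)) * X ^ j := by
    have hm := minpoly.eq_of_irreducible_of_monic hirr hroot (cyclotomic.monic r _)
    rw [hm]
    refine minpoly.dvd _ _ ?_
    have h1 : ∑ j ∈ range r, y ^ j = 0 := by simpa [hcyc] using hroot
    simp only [map_sum, map_mul, map_sub, aeval_C, map_pow, aeval_X, sub_mul, sum_sub_distrib, h,
      ← mul_sum, h1, mul_zero, sub_zero]
  have hz := eq_zero_of_dvd_of_degree_lt hdvd (by
    rw [degree_cyclotomic, Nat.totient_prime hr]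
    refine (degree_lt_iff_coeff_zero _ _).2 fun k hk => ?_
    simp only [finsetSum_coeff, coeff_C_mul, coeff_X_pow]
    refine sum_eq_zero fun n hn => ?_
    have := mem_range.1 hn
    split_ifs with hkn
    · rw [show n = r - 1 by omega, sub_self, zero_mul]
    · rw [mul_zero])
  intro j hj
  have := congrArg (fun q => coeff q j) hz
  simp only [finsetSum_coeff, coeff_C_mul, coeff_X_pow, coeff_zero] at this
  rw [sum_eq_single_of_mem j (mem_range.2 hj)] at this
  · simpa [sub_eq_zero] using this
  · intro b _ hbj
    rw [if_neg (Ne.symm hbj), mul_zero]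

/-- Odd powers of `g` are the nonsquares; the value at `x + A = 0` agrees because the quadratic
character is `0` there. -/
theorem ntuMap_two {p : ℕ} [Fact p.Prime] (hp2 : p ≠ 2) {g : ZMod p}
    (hg : IsPrimitiveRoot g (p - 1)) (A x : ZMod p) :
    ntuMap 2 g A x = if quadraticChar (ZMod p) (x + A) = -1 then 1 else 0 := by
  have hF : ringChar (ZMod p) ≠ 2 := by rwa [ZMod.ringChar_zmod_n]
  have hc : Fintype.card (ZMod p) = p := ZMod.card p
  have hg' : IsPrimitiveRoot g (Fintype.card (ZMod p) - 1) := by rwa [hc]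
  rw [ntuMap]
  split_ifs with h0 h1 h1
  · simp [h0] at h1
  · rfl
  · obtain ⟨i, hi, hix⟩ := exists_pow_eq_of_isPrimitiveRoot hg' h0
    rw [← hix] at h1 ⊢
    have ho := (quadraticChar_primitiveRoot_pow hF hg' i).1 h1
    have : sInf {k : ℕ | k < 2 ∧ g ^ i ∈ cyclotomicClass g 2 k} = 1 := by
      refine le_antisymm (Nat.sInf_le ⟨by norm_num, i / 2, ?_, ?_⟩) ?_
      · obtain ⟨k, rfl⟩ := ho
        rw [hc] at hi
        omega
      · rw [← pow_add]; congr 1; obtain ⟨k, rfl⟩ := ho; omega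
      · refine le_csInf ⟨1, by norm_num, i / 2, ?_, ?_⟩ ?_
        · obtain ⟨k, rfl⟩ := ho
          rw [hc] at hi
          omega
        · rw [← pow_add]; congr 1; obtain ⟨k, rfl⟩ := ho; omega
        rintro k ⟨hk, j, -, hj⟩
        by_contra hk0
        obtain rfl : k = 0 := by omega
        rw [hj, pow_zero, one_mul, quadraticChar_primitiveRoot_pow hF hg'] at h1
        exact Nat.not_odd_iff_even.2 (even_two.mul_left j) h1
    rw [this, Nat.cast_one]
  · obtain ⟨i, hi, hix⟩ := exists_pow_eq_of_isPrimitiveRoot hg' h0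
    rw [← hix] at h1 ⊢
    rw [quadraticChar_primitiveRoot_pow hF hg', Nat.not_odd_iff_even] at h1
    have : sInf {k : ℕ | k < 2 ∧ g ^ i ∈ cyclotomicClass g 2 k} = 0 := by
      refine le_antisymm (Nat.sInf_le ⟨by norm_num, i / 2, ?_, ?_⟩) (Nat.zero_le _)
      · have := (Fact.out : p.Prime).eq_one_or_self_of_dvd 2
        rw [hc] at hi
        obtain ⟨k, rfl⟩ := h1
        omega
      · rw [← pow_add]; congr 1; obtain ⟨k, rfl⟩ := h1; omega
    rw [this, Nat.cast_zero]

theorem sum_ntuMap_mul_pow_ne_zero {p r s : ℕ} [Fact p.Prime] (hr : r.Prime) (hr_odd : Odd r)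
    (hs : 1 ≤ s) (hp : p = 2 ^ s * r + 1) (h2 : IsPrimitiveRoot (2 : ZMod r) (r - 1))
    (hrp : p ≤ (r - 1) ^ 2) {g A : ZMod p} (hg : IsPrimitiveRoot g (p - 1)) (hA : A ≠ 0)
    {L : Type*} [Field L] [Algebra (ZMod 2) L] {y : L} (hy : y ^ (p - 1) = 1) (hy1 : y ≠ 1) :
    ∑ n ∈ range (p - 1), algebraMap (ZMod 2) L (ntuMap 2 g A (g ^ n)) * y ^ n ≠ 0 := by
  intro h
  have hr0 := hr.pos
  have hn0 : 0 < 2 ^ s := by positivity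
  have hpos : 0 < 2 ^ s * r := by positivity
  have hp1 : p - 1 = 2 ^ s * r := by omega
  have hp2 : p ≠ 2 := by
    rintro rfl
    have : 2 ^ s * r = 1 := by omega
    have := hr.one_lt
    nlinarith
  have hF : ringChar (ZMod p) ≠ 2 := by rwa [ZMod.ringChar_zmod_n]
  have hL : CharP L 2 := charP_of_injective_algebraMap (algebraMap (ZMod 2) L).injective 2
  -- In characteristic 2, `y ^ (2 ^ s * r) - 1 = (y ^ r - 1) ^ (2 ^ s)`.
  have hyr : y ^ r = 1 := by
    rw [hp1, mul_comm, pow_mul] at hy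
    have := sub_pow_char_pow (R := L) (p := 2) (y ^ r) 1 s
    rw [hy, one_pow, sub_self] at this
    exact sub_eq_zero.1 (eq_zero_of_pow_eq_zero this)
  set n := 2 ^ s with hn
  have heven : Even n := (Nat.even_pow.2 ⟨even_two, by omega⟩)
  have hgr : IsPrimitiveRoot (g ^ r) n := hg.pow (by omega) (by rw [hp1, mul_comm])
  have hgn : IsPrimitiveRoot (g ^ n) r := hg.pow (by omega) hp1
  have hη : ∀ x, ntuMap 2 g A x = if quadraticChar (ZMod p) (x + A) = -1 then 1 else 0 :=
    ntuMap_two hp2 hg A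
  have hc := coeff_eq_of_sum_pow_eq_zero hr (irreducible_cyclotomic_zmod_two hr hr_odd h2) hyr hy1
    (fun j => ∑ k ∈ range n, ntuMap 2 g A (g ^ (j + r * k))) (by
      rw [hp1, sum_range_mul_eq] at h
      rw [← h]
      refine sum_congr rfl fun j _ => ?_
      rw [map_sum, sum_mul]
      refine sum_congr rfl fun k _ => ?_
      rw [pow_add y, pow_mul y, hyr, one_pow, mul_one])
  -- The powers of `g ^ r` are the `n`-th roots of unity; since `n` is even, the sign in `(-g ^ j) ^
  -- n` disappears.
  have hprod : ∀ j, ∏ k ∈ range n, quadraticChar (ZMod p) (g ^ (j + r * k) + A)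
      = quadraticChar (ZMod p) (A ^ n - (g ^ n) ^ j) := by
    intro j
    rw [← map_prod]
    congr 1
    have := prod_range_sub_pow_mul hn0 hgr A (-g ^ j)
    rw [heven.neg_pow, ← pow_mul, mul_comm j n, pow_mul] at this
    rw [← this]
    refine prod_congr rfl fun k _ => ?_
    rw [pow_add, pow_mul]; ring
  set c := ∑ k ∈ range n, ntuMap 2 g A (g ^ (r - 1 + r * k)) with hcdef
  -- The condition `z ≠ A ^ n` ensures that no factor `g ^ (j + r * k) + A` is zero, so every
  -- character value is a sign.
  have key : ∀ z : ZMod p, z ^ r = 1 → z ≠ A ^ n →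
      quadraticChar (ZMod p) (A ^ n - z) = if c = 1 then -1 else 1 := by
    intro z hz hzA
    have : NeZero r := ⟨hr0.ne'⟩
    obtain ⟨j, hj, rfl⟩ := hgn.eq_pow_of_pow_eq_one hz
    have hd := quadraticChar_dichotomy (sub_ne_zero.2 (Ne.symm hzA))
    have hne : ∏ k ∈ range n, quadraticChar (ZMod p) (g ^ (j + r * k) + A) ≠ 0 := by
      rw [hprod]
      rcases hd with h | h <;> rw [h] <;> norm_num
    have hs := sum_ite_neg_one (range n) (fun k => quadraticChar (ZMod p) (g ^ (j + r * k) + A))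
      (fun k hk => quadraticChar_dichotomy fun h0 => prod_ne_zero_iff.1 hne k hk
        (by rw [h0, quadraticChar_zero]))
    have hcj : c = if quadraticChar (ZMod p) (A ^ n - (g ^ n) ^ j) = -1 then 1 else 0 := by
      rw [← hprod, ← hs.1, ← hc j hj]
      exact sum_congr rfl fun k _ => hη _
    rcases hd with h | h <;> rw [hcj, h] <;> norm_num
  have hAr : (A ^ n) ^ r = 1 := by
    rw [← pow_mul, ← hp1]
    exact ZMod.pow_card_sub_one_eq_one hA
  have hle := sq_card_sub_one_le hF hr0 hgn hAr key
  have hε : ((if c = 1 then -1 else 1 : ℤ)) ^ 2 = 1 := by split_ifs <;> norm_num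
  rw [hε, mul_one, ZMod.card] at hle
  zify [hr0] at hrp
  have : (0 : ℤ) < r := by exact_mod_cast hr0
  linarith

/-! ### Counting nonsquares. -/

theorem two_mul_card_nonsquares {F : Type*} [Field F] [Fintype F] [DecidableEq F]
    (hF : ringChar F ≠ 2) :
    2 * (#{x : F | quadraticChar F x = -1} : ℤ) = Fintype.card F - 1 := by
  have h : ∀ x : F, 2 * (if quadraticChar F x = -1 then (1 : ℤ) else 0)
      = 1 - quadraticChar F x - if x = 0 then 1 else 0 := by
    intro x
    rcases eq_or_ne x 0 with rfl | hx
    · rw [quadraticChar_zero]; norm_num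
    · rcases quadraticChar_dichotomy hx with h | h <;> rw [h] <;> simp [hx]
  rw [card_filter, Nat.cast_sum, mul_sum]
  simp only [Nat.cast_ite, Nat.cast_one, Nat.cast_zero]
  rw [sum_congr rfl fun x _ => h x, sum_sub_distrib, sum_sub_distrib, quadraticChar_sum_zero hF]
  simp

/-- Four times the indicator is `(1 - η x) (1 - η (x + A))`, with `η` the quadratic character,
corrected at `0` and `-A` where a factor `η` vanishes. -/
theorem four_mul_card_nonsquares_shift {F : Type*} [Field F] [Fintype F] [DecidableEq F]
    (hF : ringChar F ≠ 2) {A : F} (hA : A ≠ 0) :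
    4 * (#{x : F | quadraticChar F x = -1 ∧ quadraticChar F (x + A) = -1} : ℤ)
      = Fintype.card F - 3 + quadraticChar F A + quadraticChar F (-A) := by
  have h : ∀ x : F,
      4 * (if quadraticChar F x = -1 ∧ quadraticChar F (x + A) = -1 then (1 : ℤ) else 0)
      = 1 - quadraticChar F x - quadraticChar F (x + A) +
        quadraticChar F (x - 0) * quadraticChar F (x - -A)
        - (if x = 0 then 1 - quadraticChar F A else 0)
        - (if x = -A then 1 - quadraticChar F (-A) else 0) := by
    intro x
    rw [sub_zero, sub_neg_eq_add]
    rcases eq_or_ne x 0 with rfl | hx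
    · rw [quadraticChar_zero, zero_add, if_neg (by norm_num), if_pos rfl,
        if_neg (by simpa using hA)]
      ring
    rcases eq_or_ne x (-A) with rfl | hxA
    · rw [neg_add_cancel, quadraticChar_zero, if_neg (by norm_num), if_neg hx, if_pos rfl]
      ring
    have hx' : x + A ≠ 0 := fun h => hxA (eq_neg_of_add_eq_zero_left h)
    rw [if_neg hx, if_neg hxA]
    rcases quadraticChar_dichotomy hx with h | h <;>
      rcases quadraticChar_dichotomy hx' with h' | h' <;> rw [h, h'] <;> norm_num
  have hshift : ∑ x : F, quadraticChar F (x + A) = 0 := by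
    rw [← quadraticChar_sum_zero hF]
    exact Equiv.sum_comp (Equiv.addRight A) (fun x => quadraticChar F x)
  rw [card_filter, Nat.cast_sum, mul_sum]
  simp only [Nat.cast_ite, Nat.cast_one, Nat.cast_zero]
  rw [sum_congr rfl fun x _ => h x]
  simp only [sum_sub_distrib, sum_add_distrib]
  rw [quadraticChar_sum_zero hF, hshift,
    sum_quadraticChar_sub_mul_sub hF (by simpa using hA)]
  simp only [sum_ite_eq', mem_univ, if_true]
  simp
  ring

theorem natCast_eq_one_of_odd {R : Type*} [AddCommGroupWithOne R] [CharP R 2] {n : ℕ}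
    (h : Odd n) : (n : R) = 1 := by
  rw [CharTwo.natCast_eq_ite, if_neg (Nat.not_even_iff_odd.2 h)]

theorem natCast_eq_zero_of_even {R : Type*} [AddCommGroupWithOne R] [CharP R 2] {n : ℕ}
    (h : Even n) : (n : R) = 0 := by
  rw [CharTwo.natCast_eq_ite, if_pos h]

/-! ### Multiplicative characters summed over trace fibres. -/

section
variable {p : ℕ} [Fact p.Prime] {F : Type*} [Field F] [Fintype F]
  [Algebra (ZMod p) F] {L : Type*} [Field L]

/-- The terms at `x` and `-x` cancel: in characteristic 2, `χ (-1) ^ 2 = 1` forces `χ (-1) = 1`. -/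
theorem sum_trace_eq_zero_mulChar [CharP L 2] (hp2 : p ≠ 2) (χ : MulChar F L) :
    ∑ x with Algebra.trace (ZMod p) F x = 0, χ x = 0 := by
  have hneg : χ (-1) = 1 := by
    have h1 : χ (-1) ^ 2 = 1 := by rw [← map_pow, neg_one_sq, map_one]
    have h2 : (χ (-1) - 1) ^ 2 = 0 := by rw [sub_pow_char, h1, one_pow, sub_self]
    exact sub_eq_zero.1 (eq_zero_of_pow_eq_zero h2)
  have hF : ringChar F ≠ 2 := by
    have : CharP F p := charP_of_injective_algebraMap (algebraMap (ZMod p) F).injective p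
    rwa [ringChar.eq F p]
  refine sum_involution (fun a _ => -a) ?_ ?_ ?_ ?_
  · intro a _
    rw [← neg_one_mul, map_mul, hneg, one_mul, CharTwo.add_self_eq_zero]
  · intro a _ ha h
    refine ha ?_
    rw [(Ring.eq_self_iff_eq_zero_of_char_ne_two hF).1 h]
    exact χ.map_zero
  · intro a ha
    simpa using ha
  · intro a _; exact neg_neg a

theorem sum_trace_eq_mulChar (χ : MulChar F L) {c : ZMod p} (hc : c ≠ 0) :
    ∑ x with Algebra.trace (ZMod p) F x = c, χ x
      = χ (algebraMap (ZMod p) F c) * ∑ x with Algebra.trace (ZMod p) F x = 1, χ x := by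
  have hc' : algebraMap (ZMod p) F c ≠ 0 := by simpa using hc
  rw [mul_sum]
  refine sum_nbij' (fun x => (algebraMap (ZMod p) F c)⁻¹ * x) (fun x => algebraMap (ZMod p) F c * x)
    ?_ ?_ ?_ ?_ ?_
  · intro x hx
    simp only [mem_filter_univ] at hx ⊢
    rw [← map_inv₀, ← Algebra.smul_def, map_smul, hx, smul_eq_mul, inv_mul_cancel₀ hc]
  · intro x hx
    simp only [mem_filter_univ] at hx ⊢
    rw [← Algebra.smul_def, map_smul, hx, smul_eq_mul, mul_one]
  · intro x _; exact mul_inv_cancel_left₀ hc' x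
  · intro x _; exact inv_mul_cancel_left₀ hc' x
  · intro x _
    rw [← map_mul, mul_inv_cancel_left₀ hc']

theorem sum_trace_mul_mulChar [CharP L 2] (hp2 : p ≠ 2) (χ : MulChar F L) (f : ZMod p → L) :
    ∑ x, f (Algebra.trace (ZMod p) F x) * χ x
      = (∑ c, f c * χ (algebraMap (ZMod p) F c)) *
        ∑ x with Algebra.trace (ZMod p) F x = 1, χ x := by
  rw [← sum_fiberwise univ (fun x => Algebra.trace (ZMod p) F x), sum_mul]
  refine sum_congr rfl fun c _ => ?_
  have : ∑ x with Algebra.trace (ZMod p) F x = c, f (Algebra.trace (ZMod p) F x) * χ x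
      = f c * ∑ x with Algebra.trace (ZMod p) F x = c, χ x := by
    rw [mul_sum]
    refine sum_congr rfl fun x hx => ?_
    rw [(mem_filter.1 hx).2]
  rw [this]
  rcases eq_or_ne c 0 with rfl | hc
  · rw [sum_trace_eq_zero_mulChar hp2, map_zero, χ.map_zero]; ring
  · rw [sum_trace_eq_mulChar χ hc, mul_assoc]

/-- With `f` an additive character of `𝔽_p`, `sum_trace_mul_mulChar` exhibits this sum as a factor
of a Gauss sum on `F`. The Gauss sum is nonzero because `card F` is odd, hence nonzero in `L`; for
trivial `χ` it is `-1`. -/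
theorem sum_trace_eq_one_mulChar_ne_zero [CharP L 2] [IsAlgClosed L] (hp2 : p ≠ 2) (χ : MulChar F L) :
    ∑ x with Algebra.trace (ZMod p) F x = 1, χ x ≠ 0 := by
  have hp : p.Prime := Fact.out
  have hodd : Odd p := hp.odd_of_ne_two hp2
  have hpL : (p : L) = 1 := natCast_eq_one_of_odd hodd
  have : NeZero (p : L) := ⟨by rw [hpL]; exact one_ne_zero⟩
  obtain ⟨ζ, hζ⟩ := HasEnoughRootsOfUnity.exists_primitiveRoot L p
  set ψ₀ : AddChar (ZMod p) L := AddChar.zmodChar p hζ.pow_eq_one with hψ₀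
  have hprim : ψ₀.IsPrimitive := AddChar.zmodChar_primitive_of_primitive_root p hζ
  set ψ : AddChar F L :=
    ψ₀.compAddMonoidHom (Algebra.trace (ZMod p) F).toAddMonoidHom with hψ
  have hψ1 : ψ ≠ 1 := by
    have h0 : ψ₀ ≠ 1 := by
      have := hprim one_ne_zero
      rwa [AddChar.mulShift_one] at this
    obtain ⟨c, hc⟩ := AddChar.ne_one_iff.1 h0
    obtain ⟨x, rfl⟩ := Algebra.trace_surjective (ZMod p) F c
    exact AddChar.ne_one_iff.2 ⟨x, hc⟩
  have hg : gaussSum χ ψ ≠ 0 := by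
    rcases eq_or_ne χ 1 with rfl | hχ
    · rw [gaussSum_one_left hψ1]
      simp
    · refine gaussSum_ne_zero_of_nontrivial ?_ hχ (AddChar.IsPrimitive.of_ne_one hψ1)
      rw [Module.card_eq_pow_finrank (K := ZMod p), ZMod.card, Nat.cast_pow, hpL, one_pow]
      exact one_ne_zero
  have : gaussSum χ ψ = ∑ x, ψ₀ (Algebra.trace (ZMod p) F x) * χ x :=
    sum_congr rfl fun x _ => mul_comm _ _
  rw [this, sum_trace_mul_mulChar hp2] at hg
  exact right_ne_zero_of_mul hg

end

theorem exists_mulChar_apply_eq {F L : Type*} [Field F] [Fintype F] [Field L] {ω : F}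
    (hω : IsPrimitiveRoot ω (Fintype.card F - 1)) {y : L} (hy : y ^ (Fintype.card F - 1) = 1) :
    ∃ χ : MulChar F L, χ ω = y := by
  classical
  have hc := Fintype.one_lt_card (α := F)
  have hcu : Fintype.card Fˣ = Fintype.card F - 1 := Fintype.card_units F
  have hω0 : ω ≠ 0 := hω.ne_zero (by omega)
  have hy0 : y ≠ 0 := by
    rintro rfl
    rw [zero_pow (by omega)] at hy
    exact zero_ne_one hy
  have hζ : Units.mk0 y hy0 ∈ rootsOfUnity (Fintype.card Fˣ) L := by
    rw [mem_rootsOfUnity, hcu]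
    ext; simpa using hy
  have hgen : ∀ x : Fˣ, x ∈ Subgroup.zpowers (Units.mk0 ω hω0) := by
    intro x
    obtain ⟨i, -, hi⟩ := exists_pow_eq_of_isPrimitiveRoot hω x.ne_zero
    exact ⟨i, by ext; simpa using hi⟩
  exact ⟨MulChar.ofRootOfUnity hζ hgen, MulChar.ofRootOfUnity_spec hζ hgen⟩

/-! ### From roots and multiplicities to the minimal polynomial. -/

theorem aeval_revGenPoly {K L : Type*} [CommRing K] [Field L] [Algebra K L] {N : ℕ} (S : ℕ → K)
    {θ : L} (hN : 0 < N) (hθ : θ ^ N = 1) :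
    aeval θ (revGenPoly N S) = ∑ n ∈ range N, algebraMap K L (S n) * θ⁻¹ ^ n := by
  have h0 : θ ≠ 0 := by
    rintro rfl
    rw [zero_pow hN.ne'] at hθ
    exact zero_ne_one hθ
  rw [revGenPoly, map_sum]
  refine sum_congr rfl fun n hn => ?_
  rw [map_mul, aeval_C, map_pow, aeval_X, pow_sub₀ θ h0 (mem_range.1 hn).le, hθ, one_mul, inv_pow]

/-- Differentiation in characteristic 2 keeps only odd exponents `N - n`, that is odd `n` as `N` is
even. -/
theorem mul_aeval_derivative_revGenPoly {K L : Type*} [CommRing K] [Field L] [Algebra K L]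
    [CharP L 2] {N : ℕ} (S : ℕ → K) {θ : L} (hN : 0 < N) (hNe : Even N) (hθ : θ ^ N = 1) :
    θ * aeval θ (derivative (revGenPoly N S))
      = ∑ n ∈ range N, (if Odd n then algebraMap K L (S n) else 0) * θ⁻¹ ^ n := by
  have h0 : θ ≠ 0 := by
    rintro rfl
    rw [zero_pow hN.ne'] at hθ
    exact zero_ne_one hθ
  rw [revGenPoly, derivative_sum, map_sum, mul_sum]
  refine sum_congr rfl fun n hn => ?_
  have hlt := mem_range.1 hn
  rw [derivative_C_mul_X_pow, map_mul, aeval_C, map_pow, aeval_X, map_mul, map_natCast]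
  have e : θ * (algebraMap K L (S n) * ((N - n : ℕ) : L) * θ ^ (N - n - 1))
      = algebraMap K L (S n) * ((N - n : ℕ) : L) * θ ^ (N - n - 1 + 1) := by ring
  rw [e, show N - n - 1 + 1 = N - n by omega, pow_sub₀ θ h0 hlt.le, hθ, one_mul, inv_pow]
  congr 1
  split_ifs with ho
  · rw [natCast_eq_one_of_odd (Nat.Even.sub_odd hlt.le hNe ho), mul_one]
  · rw [natCast_eq_zero_of_even (hNe.tsub (Nat.not_odd_iff_even.1 ho)), mul_zero]

theorem X_pow_sub_one_dvd_of_roots {K : Type*} (L : Type*) [Field K] [Field L] [Algebra K L]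
    [IsAlgClosed L] {n : ℕ} (hn : 0 < n) (hnL : (n : L) ≠ 0) {P : K[X]}
    (h : ∀ θ : L, θ ^ n = 1 → aeval θ P = 0) : X ^ n - 1 ∣ P := by
  have : NeZero (n : L) := ⟨hnL⟩
  obtain ⟨ζ, hζ⟩ := HasEnoughRootsOfUnity.exists_primitiveRoot L n
  rw [← map_dvd_map' (algebraMap K L), Polynomial.map_sub, Polynomial.map_pow, map_X,
    Polynomial.map_one, X_pow_sub_one_eq_prod hn hζ]
  refine Finset.prod_dvd_of_coprime ?_ ?_
  · intro a _ b _ hab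
    exact isCoprime_X_sub_C_of_isUnit_sub (sub_ne_zero.2 hab).isUnit
  · intro θ hθ
    rw [dvd_iff_isRoot, IsRoot.def, eval_map_algebraMap]
    exact h θ ((mem_nthRootsFinset hn 1).1 hθ)

theorem minimalPolynomial_of_no_roots {K : Type*} (L : Type*) [Field K] [Field L] [Algebra K L]
    [IsAlgClosed L] {N : ℕ} (hN : 0 < N) {S : ℕ → K} (hS : ∀ n, S (n + N) = S n)
    (h : ∀ θ : L, θ ^ N = 1 → aeval θ (revGenPoly N S) ≠ 0) :
    (∀ P : K[X], IsMinimalPolynomial S P ↔ P = X ^ N - 1) ∧ linearComplexity S = N := by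
  have h1 : (X ^ N - 1 : K[X]) = X ^ N - C 1 := by rw [map_one]
  have := minimalPolynomial_of_factor hN hS (M := X ^ N - 1) (D := 1) (H := revGenPoly N S)
    (by rw [h1]; exact monic_X_pow_sub_C 1 hN.ne') one_ne_zero (mul_one _).symm (one_mul _).symm
    (isCoprime_of_no_common_root L fun θ hθ h0 => h θ (by simpa [sub_eq_zero] using hθ) h0)
  rwa [h1, natDegree_X_pow_sub_C, map_one] at this

/-- All roots of `X ^ (2νr) - 1 = (X ^ (νr) - 1) ^ 2` are double. The hypotheses make the gcd with
`G` equal to `(X ^ ν - 1) * E`, where `E = (X ^ ν - 1) / (X - 1)`; the cofactor is `(X - 1) * R ^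
2`. -/
theorem exists_minimalPolynomial_of_roots {K : Type*} (L : Type*) [Field K] [CharP K 2] [Field L]
    [Algebra K L] [IsAlgClosed L] {ν r : ℕ} (hν : Odd ν) (hr : Odd r) {S : ℕ → K}
    (hS : ∀ n, S (n + 2 * (ν * r)) = S n)
    (h1 : ∀ θ : L, θ ^ (2 * (ν * r)) = 1 → θ ^ ν ≠ 1 →
      aeval θ (revGenPoly (2 * (ν * r)) S) ≠ 0)
    (h2 : ∀ θ : L, θ ^ ν = 1 → aeval θ (revGenPoly (2 * (ν * r)) S) = 0)
    (h3 : ∀ θ : L, θ ^ ν = 1 → θ ≠ 1 → aeval θ (derivative (revGenPoly (2 * (ν * r)) S)) = 0)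
    (h4 : aeval (1 : L) (derivative (revGenPoly (2 * (ν * r)) S)) ≠ 0) :
    ∃ M : K[X], M * (X ^ (2 * ν) - 1) = (X - 1) * (X ^ (2 * (ν * r)) - 1) ∧
      (∀ P : K[X], IsMinimalPolynomial S P ↔ P = M) ∧ linearComplexity S = M.natDegree := by
  have : CharP L 2 := charP_of_injective_algebraMap (algebraMap K L).injective 2
  have hνL : (ν : L) = 1 := natCast_eq_one_of_odd hν
  have hsq : ∀ k, (X ^ (2 * k) - 1 : K[X]) = (X ^ k - 1) ^ 2 := by
    intro k
    rw [sub_pow_char, one_pow, ← pow_mul, mul_comm]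
  have hνr0 : 0 < ν * r := (hν.mul hr).pos
  set G := revGenPoly (2 * (ν * r)) S with hG
  obtain ⟨R, hR⟩ : (X ^ ν - 1 : K[X]) ∣ X ^ (ν * r) - 1 := pow_one_sub_dvd_pow_mul_sub_one X ν r
  obtain ⟨E, hE⟩ : (X - 1 : K[X]) ∣ X ^ ν - 1 := sub_one_dvd_pow_sub_one X ν
  obtain ⟨H, hH⟩ := X_pow_sub_one_dvd_of_roots L hν.pos (by rw [hνL]; exact one_ne_zero) h2
  have hder : ∀ θ : L, θ ^ ν = 1 → aeval θ (derivative G) = θ ^ (ν - 1) * aeval θ H := by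
    intro θ hθ
    rw [hH, derivative_mul, derivative_sub, derivative_X_pow, derivative_one]
    simp [hθ, hνL]
  -- The double roots `θ ≠ 1` of `G` are roots of `H`, so `(X - 1) * H` vanishes at every `ν`-th
  -- root of unity; then `X - 1` is cancelled.
  obtain ⟨H', hH'⟩ : E ∣ H := by
    have := X_pow_sub_one_dvd_of_roots (P := (X - 1) * H) L hν.pos
      (by rw [hνL]; exact one_ne_zero) fun θ hθ => by
        rcases eq_or_ne θ 1 with rfl | hθ1
        · simp
        · have h0 := h3 θ hθ hθ1
          rw [hder θ hθ] at h0
          have hθ0 : θ ≠ 0 := by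
            rintro rfl
            rw [zero_pow hν.pos.ne'] at hθ
            exact zero_ne_one hθ
          rw [map_mul, (mul_eq_zero.1 h0).resolve_left (pow_ne_zero _ hθ0), mul_zero]
    rw [hE] at this
    exact (mul_dvd_mul_iff_left (by simpa using X_sub_C_ne_zero (1 : K))).1 this
  have hsep : (X ^ (ν * r) - 1 : K[X]).Separable :=
    X_pow_sub_one_separable_iff.2 (by
      rw [natCast_eq_one_of_odd (hν.mul hr)]; exact one_ne_zero)
  have hcop : IsCoprime (X ^ ν - 1 : K[X]) R := by rw [hR] at hsep; exact hsep.isCoprime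
  have hmon : ∀ k, 0 < k → (X ^ k - 1 : K[X]).Monic := fun k hk => by
    simpa using monic_X_pow_sub_C (1 : K) hk.ne'
  have hX1 : (X - 1 : K[X]).Monic := by simpa using monic_X_sub_C (1 : K)
  have hRm : R.Monic := (hmon ν hν.pos).of_mul_monic_left (by rw [← hR]; exact hmon _ hνr0)
  have hEm : E.Monic := hX1.of_mul_monic_left (by rw [← hE]; exact hmon _ hν.pos)
  refine ⟨(X - 1) * R ^ 2, by rw [hsq, hsq, hR]; ring, ?_⟩
  refine minimalPolynomial_of_factor (D := (X ^ ν - 1) * E) (H := H') (by omega) hS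
    (hX1.mul (hRm.pow 2)) ((hmon ν hν.pos).mul hEm).ne_zero ?_ ?_ ?_
  · rw [hsq, hR]
    linear_combination R ^ 2 * (X ^ ν - 1) * hE
  · rw [← hG, hH, hH', mul_assoc]
  · refine isCoprime_of_no_common_root L fun θ hM hθ => ?_
    have hHθ : aeval θ H = 0 := by rw [hH', map_mul, hθ, mul_zero]
    rw [map_mul, map_pow, mul_eq_zero] at hM
    rcases hM with hM | hM
    · have : θ = 1 := by simpa [sub_eq_zero] using hM
      subst this
      rw [hder 1 (one_pow _), hHθ, mul_zero] at h4
      exact h4 rfl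
    · have hRθ : aeval θ R = 0 := eq_zero_of_pow_eq_zero hM
      refine h1 θ ?_ ?_ (by rw [hH, map_mul, hHθ, mul_zero])
      · have : aeval θ (X ^ (ν * r) - 1 : K[X]) = 0 := by rw [hR, map_mul, hRθ, mul_zero]
        have h5 : θ ^ (ν * r) = 1 := by simpa [sub_eq_zero] using this
        rw [mul_comm, pow_mul, h5, one_pow]
      · intro h5
        obtain ⟨a, b, hab⟩ := hcop
        have := congrArg (aeval θ) hab
        simp [hRθ, h5] at this

theorem ntuSeq_add_period {p : ℕ} {F : Type*} [Field F] [Fintype F]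
    [Algebra (ZMod p) F] {ω : F} (hω : IsPrimitiveRoot ω (Fintype.card F - 1))
    (g A : ZMod p) (n : ℕ) :
    ntuSeq 2 g A ω (n + (Fintype.card F - 1)) = ntuSeq 2 g A ω n := by
  rw [ntuSeq, ntuSeq, pow_add, hω.pow_eq_one, mul_one]

/-! ### The generating polynomial and its derivative as character sums. -/

section
variable {p : ℕ} [Fact p.Prime] {F : Type*} [Field F] [Fintype F] [Algebra (ZMod p) F]
  {L : Type*} [Field L]

theorem exists_aeval_revGenPoly_ntuSeq [Algebra (ZMod 2) L] [IsAlgClosed L] (hp2 : p ≠ 2) {ω : F}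
    (hω : IsPrimitiveRoot ω (Fintype.card F - 1)) {g : ZMod p} (hg : IsPrimitiveRoot g (p - 1))
    {ν : ℕ} (hgω : algebraMap (ZMod p) F g = ω ^ ν) (A : ZMod p) {θ : L}
    (hθ : θ ^ (Fintype.card F - 1) = 1) :
    ∃ U : L, U ≠ 0 ∧ aeval θ (revGenPoly (Fintype.card F - 1) (ntuSeq 2 g A ω))
      = (∑ n ∈ range (p - 1), algebraMap (ZMod 2) L (ntuMap 2 g A (g ^ n)) * (θ⁻¹ ^ ν) ^ n) * U := by
  have hL : CharP L 2 := charP_of_injective_algebraMap (algebraMap (ZMod 2) L).injective 2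
  have hc := Fintype.one_lt_card (α := F)
  obtain ⟨χ, hχ⟩ := exists_mulChar_apply_eq (L := L) hω (y := θ⁻¹) (by rw [inv_pow, hθ, inv_one])
  refine ⟨_, sum_trace_eq_one_mulChar_ne_zero (p := p) hp2 χ, ?_⟩
  have h1 := sum_trace_mul_mulChar hp2 χ (fun c => algebraMap (ZMod 2) L (ntuMap 2 g A c))
  rw [sum_eq_sum_range_pow hω _ (by rw [χ.map_zero, mul_zero]),
    sum_eq_sum_range_pow (F := ZMod p) (ω := g) (by rwa [ZMod.card])
      (fun c => algebraMap (ZMod 2) L (ntuMap 2 g A c) * χ (algebraMap (ZMod p) F c))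
      (by simp only [map_zero, χ.map_zero, mul_zero]), ZMod.card] at h1
  rw [aeval_revGenPoly _ (by omega) hθ]
  simp only [map_pow, hgω, hχ] at h1
  exact h1

/-- Scaling by `a ^ 2` with `a` in `𝔽_p` preserves nonsquares of `F` and values of `χ`. Hence the
fibre sums `V c` depend only on the quadratic class of `c`, and `f - 1` sums to zero over each
class. -/
theorem sum_nonsquare_trace_mul_mulChar [DecidableEq F] (χ : MulChar F L)
    (hχ : ∀ c : ZMod p, c ≠ 0 → χ (algebraMap (ZMod p) F c) = 1) {f : ZMod p → L} (h0 : f 0 = 1)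
    (h1 : ∑ c with quadraticChar (ZMod p) c = 1, (f c - 1) = 0)
    (h2 : ∑ c with quadraticChar (ZMod p) c = -1, (f c - 1) = 0) :
    ∑ x, (if quadraticChar F x = -1 then f (Algebra.trace (ZMod p) F x) * χ x else 0)
      = ∑ x, if quadraticChar F x = -1 then χ x else 0 := by
  set w : F → L := fun x => if quadraticChar F x = -1 then χ x else 0 with hw
  set V : ZMod p → L := fun c => ∑ x with Algebra.trace (ZMod p) F x = c, w x with hV
  have hVmul : ∀ a c : ZMod p, a ≠ 0 → V (a ^ 2 * c) = V c := by
    intro a c ha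
    have ha2 : a ^ 2 ≠ 0 := pow_ne_zero 2 ha
    have ha' : algebraMap (ZMod p) F a ≠ 0 := by simpa using ha
    have ha'' : algebraMap (ZMod p) F (a ^ 2) ≠ 0 := by simpa using ha2
    refine sum_nbij' (fun x => (algebraMap (ZMod p) F (a ^ 2))⁻¹ * x)
      (fun x => algebraMap (ZMod p) F (a ^ 2) * x) ?_ ?_ ?_ ?_ ?_
    · intro x hx
      simp only [mem_filter_univ] at hx ⊢
      rw [← map_inv₀, ← Algebra.smul_def, map_smul, hx, smul_eq_mul, inv_mul_cancel_left₀ ha2]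
    · intro x hx
      simp only [mem_filter_univ] at hx ⊢
      rw [← Algebra.smul_def, map_smul, hx, smul_eq_mul]
    · intro x _; exact mul_inv_cancel_left₀ ha'' x
    · intro x _; exact inv_mul_cancel_left₀ ha'' x
    · intro x _
      have hx : w (algebraMap (ZMod p) F (a ^ 2) * ((algebraMap (ZMod p) F (a ^ 2))⁻¹ * x))
          = w ((algebraMap (ZMod p) F (a ^ 2))⁻¹ * x) := by
        simp only [hw]
        rw [map_mul χ, hχ _ ha2, one_mul, map_mul (quadraticChar F), map_pow (algebraMap _ _),
          quadraticChar_sq_one' ha', one_mul]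
      rwa [mul_inv_cancel_left₀ ha''] at hx
  have hVconst : ∀ c d : ZMod p, c ≠ 0 →
      quadraticChar (ZMod p) c = quadraticChar (ZMod p) d → V d = V c := by
    intro c d hc hcd
    have hd : d ≠ 0 := fun h => by
      rw [h, quadraticChar_zero, quadraticChar_eq_zero_iff] at hcd
      exact hc hcd
    have hq : quadraticChar (ZMod p) (d * c) = 1 := by
      rw [map_mul, hcd, ← sq, quadraticChar_sq_one hd]
    obtain ⟨b, hb⟩ := (quadraticChar_one_iff_isSquare (mul_ne_zero hd hc)).1 hq
    have hb0 : b ≠ 0 := by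
      rintro rfl
      rw [mul_zero] at hb
      exact mul_ne_zero hd hc hb
    have := hVmul (b / c) c (div_ne_zero hb0 hc)
    rwa [show (b / c) ^ 2 * c = d by
      rw [div_pow, sq b, ← hb]; field_simp] at this
  have hpart : ∀ ε : ℤ, ε ≠ 0 → ∑ c with quadraticChar (ZMod p) c = ε, (f c - 1) = 0 →
      ∑ c with quadraticChar (ZMod p) c = ε, (f c - 1) * V c = 0 := by
    intro ε hε hs
    rcases (univ.filter fun c => quadraticChar (ZMod p) c = ε).eq_empty_or_nonempty with h | ⟨d, hd⟩
    · rw [h, sum_empty]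
    · have hd' := (mem_filter.1 hd).2
      rw [← zero_mul (V d), ← hs, sum_mul]
      refine sum_congr rfl fun c hc => ?_
      rw [hVconst d c ?_ (hd'.trans (mem_filter.1 hc).2.symm)]
      rintro rfl
      rw [quadraticChar_zero] at hd'
      exact hε hd'.symm
  have hsplit : ∀ c : ZMod p, (f c - 1) * V c
      = (if quadraticChar (ZMod p) c = 1 then (f c - 1) * V c else 0) +
        if quadraticChar (ZMod p) c = -1 then (f c - 1) * V c else 0 := by
    intro c
    rcases eq_or_ne c 0 with rfl | hc
    · rw [h0, sub_self, zero_mul, ite_self, ite_self, add_zero]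
    · rcases quadraticChar_dichotomy hc with h | h <;> rw [h] <;> norm_num
  have htot : ∑ c, (f c - 1) * V c = 0 := by
    rw [sum_congr rfl fun c _ => hsplit c, sum_add_distrib, ← sum_filter, ← sum_filter,
      hpart 1 one_ne_zero h1, hpart (-1) (by norm_num) h2, add_zero]
  rw [← sub_eq_zero, ← sum_sub_distrib, ← htot,
    ← sum_fiberwise univ (fun x => Algebra.trace (ZMod p) F x)]
  refine sum_congr rfl fun c _ => ?_
  rw [hV, mul_sum]
  refine sum_congr rfl fun x hx => ?_
  rw [(mem_filter.1 hx).2, hw]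
  simp only
  split_ifs <;> ring

end

/-- Scaling by `ω ^ 2` multiplies the sum by `χ ω ^ 2`, which in characteristic 2 is `1` only if `χ
ω` is. -/
theorem sum_nonsquare_mulChar {F L : Type*} [Field F] [Fintype F] [DecidableEq F] [Field L]
    [CharP L 2] {ω : F} (hω : IsPrimitiveRoot ω (Fintype.card F - 1)) (χ : MulChar F L)
    (h : χ ω ≠ 1) : ∑ x, (if quadraticChar F x = -1 then χ x else 0) = 0 := by
  have hc := Fintype.one_lt_card (α := F)
  have hω0 : ω ≠ 0 := hω.ne_zero (by omega)
  set T := ∑ x, (if quadraticChar F x = -1 then χ x else 0) with hT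
  have h1 : χ ω ^ 2 * T = T := by
    conv_rhs => rw [hT, ← Equiv.sum_comp (Equiv.mulLeft₀ (ω ^ 2) (pow_ne_zero 2 hω0))]
    rw [hT, mul_sum]
    refine sum_congr rfl fun x _ => ?_
    rw [Equiv.mulLeft₀_apply, map_mul (quadraticChar F), quadraticChar_sq_one' hω0, one_mul,
      map_mul χ, map_pow]
    split_ifs <;> simp
  have h2 : (χ ω - 1) ^ 2 * T = 0 := by
    rw [sub_pow_char, one_pow, sub_mul, h1, one_mul, sub_self]
  exact (mul_eq_zero.1 h2).resolve_left (pow_ne_zero 2 (sub_ne_zero.2 h))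

/-! ### Parities of sums of `ρ_A` over `𝔽_p`. -/

section
variable {p : ℕ} [Fact p.Prime]

theorem sum_ntuMap_two (hp2 : p ≠ 2) {g : ZMod p} (hg : IsPrimitiveRoot g (p - 1)) (A : ZMod p) :
    ∑ c, ntuMap 2 g A c = ((p - 1) / 2 : ℕ) := by
  have hF : ringChar (ZMod p) ≠ 2 := by rwa [ZMod.ringChar_zmod_n]
  have h := two_mul_card_nonsquares hF
  rw [ZMod.card] at h
  simp_rw [ntuMap_two hp2 hg]
  refine (Equiv.sum_comp (Equiv.addRight A)
    (fun x => if quadraticChar (ZMod p) x = -1 then (1 : ZMod 2) else 0)).trans ?_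
  rw [sum_boole]
  congr 1
  omega

theorem sum_range_ntuMap_two (hp2 : p ≠ 2) {g : ZMod p} (hg : IsPrimitiveRoot g (p - 1))
    (A : ZMod p) : ∑ n ∈ range (p - 1), ntuMap 2 g A (g ^ n)
      = ((p - 1) / 2 : ℕ) - if quadraticChar (ZMod p) A = -1 then 1 else 0 := by
  have hp := (Fact.out : p.Prime).two_le
  have hg0 : g ≠ 0 := hg.ne_zero (by omega)
  have h := sum_eq_sum_range_pow (F := ZMod p) (ω := g) (by rwa [ZMod.card])
    (fun c => if c = 0 then 0 else ntuMap 2 g A c) (if_pos rfl)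
  rw [ZMod.card, sum_congr rfl (g := fun n => ntuMap 2 g A (g ^ n))
    (fun n _ => if_neg (pow_ne_zero n hg0))] at h
  have h0 : ntuMap 2 g A 0 = if quadraticChar (ZMod p) A = -1 then 1 else 0 := by
    rw [ntuMap_two hp2 hg, zero_add]
  rw [← h, ← sum_ntuMap_two hp2 hg A, eq_sub_iff_add_eq, ← h0, ← add_sum_erase univ _ (mem_univ (0 : ZMod p)),
    ← add_sum_erase univ (fun c => ntuMap 2 g A c) (mem_univ (0 : ZMod p)), if_pos rfl, zero_add,
    add_comm]
  congr 1
  exact sum_congr rfl fun c hc => if_neg (mem_erase.1 hc).1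

/-- As `-1` is a nonsquare, the contributions of `A` and `-A` to the shifted count cancel. The two
counts are `(p - 3) / 4` and `(p - 1) / 2`, both odd for `p ≡ 7 (mod 8)`. -/
theorem sum_nonsquare_ntuMap_sub_one {g : ZMod p} (hg : IsPrimitiveRoot g (p - 1)) {A : ZMod p}
    (hp : p % 8 = 7) (hA : quadraticChar (ZMod p) A = -1) :
    ∑ c with quadraticChar (ZMod p) c = -1, (ntuMap 2 g A c - 1) = 0 := by
  have hp2 : p ≠ 2 := by omega
  have hF : ringChar (ZMod p) ≠ 2 := by rwa [ZMod.ringChar_zmod_n]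
  have hA0 : A ≠ 0 := by rintro rfl; rw [quadraticChar_zero] at hA; norm_num at hA
  have hneg : quadraticChar (ZMod p) (-1) = -1 := by
    rw [quadraticChar_neg_one_iff_not_isSquare, FiniteField.isSquare_neg_one_iff, ZMod.card]
    omega
  have h1 := two_mul_card_nonsquares hF
  have h2 := four_mul_card_nonsquares_shift hF hA0
  rw [← neg_one_mul A, map_mul, hneg, hA, ZMod.card] at h2
  rw [ZMod.card] at h1
  simp_rw [ntuMap_two hp2 hg]
  rw [sum_sub_distrib, sum_boole, filter_filter, sum_const, nsmul_one,
    natCast_eq_one_of_odd, natCast_eq_one_of_odd, sub_self]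
  · rw [Nat.odd_iff]; omega
  · rw [Nat.odd_iff]; omega

theorem sum_square_ntuMap_sub_one {g : ZMod p} (hg : IsPrimitiveRoot g (p - 1)) {A : ZMod p}
    (hp : p % 8 = 7) (hA : quadraticChar (ZMod p) A = -1) :
    ∑ c with quadraticChar (ZMod p) c = 1, (ntuMap 2 g A c - 1) = 0 := by
  have hp2 : p ≠ 2 := by omega
  have h0 : ntuMap 2 g A 0 = 1 := by rw [ntuMap_two hp2 hg, zero_add, if_pos hA]
  have hsplit : ∀ c : ZMod p, ntuMap 2 g A c - 1
      = (if quadraticChar (ZMod p) c = 1 then ntuMap 2 g A c - 1 else 0) +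
        if quadraticChar (ZMod p) c = -1 then ntuMap 2 g A c - 1 else 0 := by
    intro c
    rcases eq_or_ne c 0 with rfl | hc
    · rw [h0, sub_self, ite_self, ite_self, add_zero]
    · rcases quadraticChar_dichotomy hc with h | h <;> rw [h] <;> norm_num
  have htot : ∑ c, (ntuMap 2 g A c - 1) = 0 := by
    rw [sum_sub_distrib, sum_ntuMap_two hp2 hg, sum_const, card_univ, ZMod.card, nsmul_one,
      natCast_eq_one_of_odd, natCast_eq_one_of_odd, sub_self]
    · rw [Nat.odd_iff]; omega
    · rw [Nat.odd_iff]; omega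
  rw [sum_congr rfl fun c _ => hsplit c, sum_add_distrib, ← sum_filter, ← sum_filter,
    sum_nonsquare_ntuMap_sub_one hg hp hA, add_zero] at htot
  exact htot

end

/-! ### The two cases over a general extension `F`. -/

section
variable {p r : ℕ} [Fact p.Prime] {F : Type*} [Field F] [Fintype F] [Algebra (ZMod p) F]

theorem ntuSeq_minimalPolynomial_of_sum_eq_one {s : ℕ} (hr : r.Prime) (hr_odd : Odd r)
    (hs : 1 ≤ s) (hp : p = 2 ^ s * r + 1) (h2 : IsPrimitiveRoot (2 : ZMod r) (r - 1))
    (hrp : p ≤ (r - 1) ^ 2) (hp2 : p ≠ 2) {ω : F}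
    (hω : IsPrimitiveRoot ω (Fintype.card F - 1)) {g A : ZMod p} (hg : IsPrimitiveRoot g (p - 1))
    {ν : ℕ} (hν : Fintype.card F - 1 = ν * (p - 1)) (hgω : algebraMap (ZMod p) F g = ω ^ ν)
    (hA : A ≠ 0) (hsum : ∑ n ∈ range (p - 1), ntuMap 2 g A (g ^ n) = 1) :
    (∀ P : (ZMod 2)[X], IsMinimalPolynomial (ntuSeq 2 g A ω) P ↔
      P = X ^ (Fintype.card F - 1) - 1) ∧
      linearComplexity (ntuSeq 2 g A ω) = Fintype.card F - 1 := by
  have hc := Fintype.one_lt_card (α := F)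
  refine minimalPolynomial_of_no_roots (AlgebraicClosure (ZMod 2)) (by omega)
    (ntuSeq_add_period hω g A) fun θ hθ => ?_
  obtain ⟨U, hU, h⟩ := exists_aeval_revGenPoly_ntuSeq hp2 hω hg hgω A hθ
  rw [h]
  refine mul_ne_zero ?_ hU
  rcases eq_or_ne (θ⁻¹ ^ ν) 1 with hy | hy
  · simp only [hy, one_pow, mul_one]
    rw [← map_sum, hsum, map_one]
    exact one_ne_zero
  · refine sum_ntuMap_mul_pow_ne_zero hr hr_odd hs hp h2 hrp hg hA ?_ hy
    rw [← pow_mul, ← hν, inv_pow, hθ, inv_one]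

theorem mul_aeval_derivative_revGenPoly_ntuSeq {L : Type*} [Field L] [DecidableEq L]
    [Algebra (ZMod 2) L] [CharP L 2] (hp8 : p % 8 = 7) {ω : F} (hω : IsPrimitiveRoot ω (Fintype.card F - 1))
    {g A : ZMod p} (hg : IsPrimitiveRoot g (p - 1)) {ν : ℕ}
    (hN : Even (Fintype.card F - 1)) (hgω : algebraMap (ZMod p) F g = ω ^ ν)
    (hA : quadraticChar (ZMod p) A = -1) {θ : L} (hθ : θ ^ (Fintype.card F - 1) = 1)
    (hθν : θ ^ ν = 1) :
    θ * aeval θ (derivative (revGenPoly (Fintype.card F - 1) (ntuSeq 2 g A ω)))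
      = if θ = 1 then (((Fintype.card F - 1) / 2 : ℕ) : L) else 0 := by
  classical
  have hp2 : p ≠ 2 := by omega
  have hF : ringChar F ≠ 2 := by
    have : CharP F p := charP_of_injective_algebraMap (algebraMap (ZMod p) F).injective p
    rwa [ringChar.eq F p]
  have hc := Fintype.one_lt_card (α := F)
  obtain ⟨χ, hχ⟩ := exists_mulChar_apply_eq (L := L) hω (y := θ⁻¹) (by rw [inv_pow, hθ, inv_one])
  have hχ1 : ∀ c : ZMod p, c ≠ 0 → χ (algebraMap (ZMod p) F c) = 1 := by
    intro c hc
    obtain ⟨i, -, rfl⟩ := exists_pow_eq_of_isPrimitiveRoot (F := ZMod p) (ω := g)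
      (by rwa [ZMod.card]) hc
    rw [map_pow, hgω, map_pow, map_pow, hχ, inv_pow, hθν, inv_one, one_pow]
  have h1 := sum_nonsquare_trace_mul_mulChar χ hχ1
    (f := fun c => algebraMap (ZMod 2) L (ntuMap 2 g A c))
    (by rw [ntuMap_two hp2 hg, zero_add, if_pos hA, map_one])
    (by
      have := congrArg (algebraMap (ZMod 2) L) (sum_square_ntuMap_sub_one hg hp8 hA)
      simpa only [map_sum, map_sub, map_one, map_zero] using this)
    (by
      have := congrArg (algebraMap (ZMod 2) L) (sum_nonsquare_ntuMap_sub_one hg hp8 hA)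
      simpa only [map_sum, map_sub, map_one, map_zero] using this)
  have h2 : θ * aeval θ (derivative (revGenPoly (Fintype.card F - 1) (ntuSeq 2 g A ω)))
      = ∑ x, if quadraticChar F x = -1 then χ x else 0 := by
    rw [← h1, mul_aeval_derivative_revGenPoly _ (by omega) hN hθ,
      sum_eq_sum_range_pow hω _ (by rw [quadraticChar_zero]; norm_num)]
    refine sum_congr rfl fun n _ => ?_
    simp only [quadraticChar_primitiveRoot_pow hF hω, map_pow χ, hχ]
    rw [ite_mul, zero_mul]
    rfl
  rw [h2]
  split_ifs with h
  · have hχ' : χ ω = 1 := by rw [hχ, h, inv_one]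
    have h3 : ∀ x : F, (if quadraticChar F x = -1 then χ x else 0)
        = if quadraticChar F x = -1 then 1 else 0 := by
      intro x
      rcases eq_or_ne x 0 with rfl | hx
      · rw [quadraticChar_zero]; norm_num
      · obtain ⟨i, -, rfl⟩ := exists_pow_eq_of_isPrimitiveRoot hω hx
        rw [map_pow χ, hχ', one_pow]
    -- At `θ = 1` the character is trivial and the sum counts the nonsquares of `F`.
    rw [sum_congr rfl fun x _ => h3 x, sum_boole]
    congr 1
    have := two_mul_card_nonsquares hF
    omega
  · refine sum_nonsquare_mulChar hω χ ?_
    rwa [hχ, ne_eq, inv_eq_one]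

theorem exists_ntuSeq_minimalPolynomial (hr : r.Prime) (hr_odd : Odd r)
    (hp : p = 2 * r + 1) (h2 : IsPrimitiveRoot (2 : ZMod r) (r - 1))
    (hrp : p ≤ (r - 1) ^ 2) (hp8 : p % 8 = 7) {ω : F}
    (hω : IsPrimitiveRoot ω (Fintype.card F - 1)) {g A : ZMod p} (hg : IsPrimitiveRoot g (p - 1))
    {ν : ℕ} (hν : Fintype.card F - 1 = ν * (p - 1)) (hν_odd : Odd ν)
    (hgω : algebraMap (ZMod p) F g = ω ^ ν) (hA : quadraticChar (ZMod p) A = -1) :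
    ∃ M : (ZMod 2)[X],
      M * (X ^ (2 * ν) - 1) = (X - 1) * (X ^ (Fintype.card F - 1) - 1) ∧
      (∀ P : (ZMod 2)[X], IsMinimalPolynomial (ntuSeq 2 g A ω) P ↔ P = M) ∧
      linearComplexity (ntuSeq 2 g A ω) = M.natDegree := by
  classical
  have hc := Fintype.one_lt_card (α := F)
  have hp2 : p ≠ 2 := by omega
  have hA0 : A ≠ 0 := by rintro rfl; rw [quadraticChar_zero] at hA; norm_num at hA
  have hN : Fintype.card F - 1 = 2 * (ν * r) := by
    rw [hν, show p - 1 = 2 * r by omega]; ring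
  have hsum : ∑ n ∈ range (p - 1), ntuMap 2 g A (g ^ n) = 0 := by
    rw [sum_range_ntuMap_two hp2 hg, if_pos hA, natCast_eq_one_of_odd, sub_self]
    rw [Nat.odd_iff]; omega
  have hdiv : ∀ θ : AlgebraicClosure (ZMod 2), θ ^ ν = 1 → θ ^ (Fintype.card F - 1) = 1 :=
    fun θ h => by rw [hν, pow_mul, h, one_pow]
  have hder := fun θ hθ => mul_aeval_derivative_revGenPoly_ntuSeq
    (L := AlgebraicClosure (ZMod 2)) hp8 hω hg (hN ▸ even_two_mul _) hgω hA (hdiv θ hθ) hθ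
  have hval := fun θ hθ => exists_aeval_revGenPoly_ntuSeq (L := AlgebraicClosure (ZMod 2)) hp2 hω
    hg hgω A (θ := θ) hθ
  have hper := ntuSeq_add_period hω g A
  rw [hN] at hder hval hper hdiv ⊢
  refine exists_minimalPolynomial_of_roots (AlgebraicClosure (ZMod 2)) hν_odd hr_odd hper
    ?_ ?_ ?_ ?_
  · intro θ hθ hθν
    obtain ⟨U, hU, h⟩ := hval θ hθ
    rw [h]
    refine mul_ne_zero (sum_ntuMap_mul_pow_ne_zero hr hr_odd (s := 1) le_rfl (by rw [hp, pow_one])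
      h2 hrp hg hA0 ?_ ?_) hU
    · rw [← pow_mul, ← hν, hN, inv_pow, hθ, inv_one]
    · rwa [inv_pow, ne_eq, inv_eq_one]
  · intro θ hθ
    obtain ⟨U, -, h⟩ := hval θ (hdiv θ hθ)
    rw [h]
    simp only [inv_pow, hθ, inv_one, one_pow, mul_one]
    rw [← map_sum, hsum, map_zero, zero_mul]
  · intro θ hθ hθ1
    have h := hder θ hθ
    rw [if_neg hθ1] at h
    refine (mul_eq_zero.1 h).resolve_left ?_
    rintro rfl
    rw [zero_pow hν_odd.pos.ne'] at hθ
    exact zero_ne_one hθ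
  · have h := hder 1 (one_pow _)
    rw [if_pos rfl, one_mul, Nat.mul_div_cancel_left _ two_pos,
      natCast_eq_one_of_odd (hν_odd.mul hr_odd)] at h
    rw [h]
    exact one_ne_zero

end

/-- The trace of `𝔽_p` over itself is the identity, so results on `ntuSeq` apply to `t_A` with `ν =
1`. -/
theorem ntuSeq_self {p : ℕ} (ℓ : ℕ) (g A : ZMod p) [Fact p.Prime] :
    ntuSeq ℓ g A g = ntuShortSeq ℓ g A := by
  funext n
  rw [ntuSeq, ntuShortSeq, Algebra.trace_self_apply]

end

/-! ### Assembling the theorem. -/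

open Polynomial in
theorem mainTheorem2
    (p m r s : ℕ) [Fact p.Prime] (hm : 1 < m)
    (hr : r.Prime) (hr_odd : Odd r) (hp : p = 2 ^ s * r + 1)
    (h2 : IsPrimitiveRoot (2 : ZMod r) (r - 1))
    (hrp : Real.sqrt p + 1 ≤ r)
    (F : Type*) [Field F] [Algebra (ZMod p) F] (hF : Module.finrank (ZMod p) F = m)
    (ω : F) (hω : IsPrimitiveRoot ω (p ^ m - 1))
    (ν : ℕ) (hν : ν = (p ^ m - 1) / (p - 1))
    (g : ZMod p) (hg : algebraMap (ZMod p) F g = ω ^ ν)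
    (A : ZMod p) :
    (((A = 1 ∧ s = 1) ∨ (quadraticChar (ZMod p) A = -1 ∧ 2 ≤ s)) →
      (∀ P : (ZMod 2)[X],
        IsMinimalPolynomial (ntuShortSeq 2 g A) P ↔ P = X ^ (p - 1) + 1) ∧
      (∀ P : (ZMod 2)[X],
        IsMinimalPolynomial (ntuSeq 2 g A ω) P ↔ P = X ^ (p ^ m - 1) + 1) ∧
      linearComplexity (ntuShortSeq 2 g A) = p - 1 ∧
      linearComplexity (ntuSeq 2 g A ω) = p ^ m - 1) ∧
    ((quadraticChar (ZMod p) A = -1 ∧ Odd m ∧ p % 8 = 7) →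
      (∀ P : (ZMod 2)[X],
        IsMinimalPolynomial (ntuShortSeq 2 g A) P ↔ P * (X + 1) = X ^ (p - 1) + 1) ∧
      (∀ P : (ZMod 2)[X],
        IsMinimalPolynomial (ntuSeq 2 g A ω) P ↔
          P * (X ^ (2 * ν) + 1) = (X + 1) * (X ^ (p ^ m - 1) + 1)) ∧
      linearComplexity (ntuShortSeq 2 g A) = p - 2 ∧
      (linearComplexity (ntuSeq 2 g A ω) : ℚ) =
        ((p : ℚ) ^ (m + 1) - 3 * (p : ℚ) ^ m + 2) / ((p : ℚ) - 1)) := by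
  have hpp : p.Prime := Fact.out
  have hp1 : 1 ≤ p := hpp.one_le
  have hr3 : 3 ≤ r := by
    have := hr.two_le
    obtain ⟨k, rfl⟩ := hr_odd
    omega
  have hrp' : p ≤ (r - 1) ^ 2 := by
    have h1 : Real.sqrt p ≤ ((r - 1 : ℕ) : ℝ) := by
      rw [Nat.cast_pred (by omega)]; linarith
    rw [Real.sqrt_le_left (by positivity)] at h1
    exact_mod_cast h1
  have hp2 : p ≠ 2 := by
    rintro rfl
    have h1 : 2 ^ s * r = 1 := by omega
    exact absurd (Nat.eq_one_of_mul_eq_one_left h1) (by omega)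
  have : FiniteDimensional (ZMod p) F := FiniteDimensional.of_finrank_pos (by omega)
  have : Finite F := Module.finite_of_finite (ZMod p)
  have : Fintype F := Fintype.ofFinite F
  have hcard : Fintype.card F = p ^ m := by
    rw [Module.card_eq_pow_finrank (K := ZMod p), ZMod.card, hF]
  have hνmul : p ^ m - 1 = ν * (p - 1) := by
    rw [hν, Nat.div_mul_cancel]
    simpa using Nat.sub_dvd_pow_sub_pow p 1 m
  have hpm : 0 < p ^ m - 1 := Nat.sub_pos_of_lt (Nat.one_lt_pow (by omega) hpp.one_lt)
  have hgprim : IsPrimitiveRoot g (p - 1) :=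
    IsPrimitiveRoot.of_map_of_injective (f := algebraMap (ZMod p) F)
      (by rw [hg]; exact hω.pow hpm hνmul) (algebraMap (ZMod p) F).injective
  have hcp : Fintype.card (ZMod p) = p := ZMod.card p
  rw [← hcard] at hω
  have hgg : algebraMap (ZMod p) (ZMod p) g = g ^ 1 := by simp
  have hgω : IsPrimitiveRoot g (Fintype.card (ZMod p) - 1) := by rwa [hcp]
  constructor
  · intro hcase
    have hs1 : 1 ≤ s := by
      rcases hcase with ⟨-, h⟩ | ⟨-, h⟩ <;> omega
    have hA : A ≠ 0 := by
      rcases hcase with ⟨rfl, -⟩ | ⟨h, -⟩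
      · exact one_ne_zero
      · rintro rfl
        rw [quadraticChar_zero] at h
        norm_num at h
    -- Either `(p - 1) / 2 = r` is odd and `A = 1` is a square, or `(p - 1) / 2` is even and the
    -- nonsquare `A` contributes `-1 = 1`.
    have hsum : ∑ n ∈ Finset.range (p - 1), ntuMap 2 g A (g ^ n) = 1 := by
      rw [sum_range_ntuMap_two hp2 hgprim]
      rcases hcase with ⟨rfl, rfl⟩ | ⟨h, hs2⟩
      · rw [map_one, if_neg (by norm_num), natCast_eq_one_of_odd, sub_zero]
        rwa [hp, Nat.add_sub_cancel, pow_one, Nat.mul_div_cancel_left _ two_pos]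
      · rw [if_pos h, natCast_eq_zero_of_even]
        · decide
        · obtain ⟨k, rfl⟩ := Nat.exists_eq_add_of_le hs2
          rw [hp, Nat.add_sub_cancel, pow_add]
          exact ⟨2 ^ k * r, by
            rw [show 2 ^ 2 * 2 ^ k * r = 2 * (2 * (2 ^ k * r)) by ring,
              Nat.mul_div_cancel_left _ two_pos]; ring⟩
    have hT := ntuSeq_minimalPolynomial_of_sum_eq_one hr hr_odd hs1 hp h2 hrp' hp2 hω hgprim
      (by rw [hcard, hνmul]) hg hA hsum
    have ht := ntuSeq_minimalPolynomial_of_sum_eq_one hr hr_odd hs1 hp h2 hrp' hp2 hgω hgprim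
      (by rw [hcp, one_mul]) hgg hA hsum
    rw [ntuSeq_self, hcp] at ht
    rw [hcard] at hT
    simp only [CharTwo.sub_eq_add] at ht hT
    exact ⟨ht.1, hT.1, ht.2, hT.2⟩
  · rintro ⟨hA, hm_odd, hp8⟩
    -- `s = 0` would make `p` even, and `s ≥ 2` would give `p ≡ 1 (mod 4)`.
    have hs : s = 1 := by
      rcases Nat.lt_or_ge s 2 with h | h
      · rcases Nat.lt_or_ge s 1 with h' | h'
        · obtain rfl : s = 0 := by omega
          obtain ⟨k, rfl⟩ := hr_odd
          omega
        · omega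
      · obtain ⟨k, rfl⟩ := Nat.exists_eq_add_of_le h
        rw [pow_add, show 2 ^ 2 * 2 ^ k * r = 4 * (2 ^ k * r) by ring] at hp
        omega
    have hp' : p = 2 * r + 1 := by rw [hp, hs, pow_one]
    have hp_odd : Odd p := hpp.odd_of_ne_two hp2
    have hν_odd : Odd ν := by
      have : ν = ∑ i ∈ Finset.range m, p ^ i := by
        rw [hν, Nat.geomSum_eq hpp.two_le]
      rw [this, Finset.odd_sum_iff_odd_card_odd, Finset.filter_true_of_mem fun i _ => hp_odd.pow,
        Finset.card_range]
      exact hm_odd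
    obtain ⟨M, hM, hMP, hML⟩ := exists_ntuSeq_minimalPolynomial hr hr_odd hp' h2 hrp' hp8 hω hgprim
      (by rw [hcard, hνmul]) hν_odd hg hA
    obtain ⟨M', hM', hMP', hML'⟩ := exists_ntuSeq_minimalPolynomial hr hr_odd hp' h2 hrp' hp8 hgω
      hgprim (by rw [hcp, one_mul]) odd_one hgg hA
    rw [ntuSeq_self] at hMP' hML'
    rw [hcp] at hM'
    rw [hcard] at hM
    have hmon : ∀ k, 0 < k → (X ^ k - 1 : (ZMod 2)[X]).Monic := fun k hk => by
      simpa using monic_X_pow_sub_C (1 : ZMod 2) hk.ne'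
    have hX1 : (X - 1 : (ZMod 2)[X]).Monic := by simpa using monic_X_sub_C (1 : ZMod 2)
    have hdeg : ∀ k, (X ^ k - 1 : (ZMod 2)[X]).natDegree = k := fun k => by
      simpa using natDegree_X_pow_sub_C (n := k) (r := (1 : ZMod 2))
    have hdeg1 : (X - 1 : (ZMod 2)[X]).natDegree = 1 := by
      simpa using natDegree_X_sub_C (1 : ZMod 2)
    have hcount : ∀ (Q : (ZMod 2)[X]) (k N : ℕ), 0 < k → 0 < N →
        Q * (X ^ k - 1) = (X - 1) * (X ^ N - 1) → Q.natDegree + k = 1 + N := by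
      intro Q k N hk hN h
      have hQ : Q ≠ 0 := by
        rintro rfl
        rw [zero_mul] at h
        exact (hX1.mul (hmon N hN)).ne_zero h.symm
      have := congrArg natDegree h
      rwa [natDegree_mul hQ (hmon k hk).ne_zero, hX1.natDegree_mul (hmon N hN), hdeg, hdeg,
        hdeg1] at this
    have hd := hcount M (2 * ν) (p ^ m - 1) (by have := hν_odd.pos; omega) hpm hM
    have hd' := hcount M' (2 * 1) (p - 1) (by norm_num) (by omega) hM'
    have hM0 := (hmon (2 * ν) (by have := hν_odd.pos; omega)).ne_zero
    simp only [CharTwo.sub_eq_add] at hM hM' hM0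
    have hX1' := hX1.ne_zero
    rw [CharTwo.sub_eq_add] at hX1'
    -- For `ν = 1` one factor `X + 1` cancels, leaving the stated form for `t_A`.
    have hsq : (X ^ (2 * 1) + 1 : (ZMod 2)[X]) = (X + 1) * (X + 1) := by
      rw [CharTwo.add_mul_self]; ring
    rw [hsq, ← mul_assoc, mul_comm (X + 1 : (ZMod 2)[X])] at hM'
    have hM'' := mul_right_cancel₀ hX1' hM'
    refine ⟨fun P => ?_, fun P => ?_, ?_, ?_⟩
    · rw [hMP', ← hM'', mul_left_inj' hX1']
    · rw [hMP, ← hM, mul_left_inj' hM0]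
    · rw [hML']; omega
    · have hpm1 : 1 ≤ p ^ m := by omega
      have hpQ : (p : ℚ) - 1 ≠ 0 := by
        rw [sub_ne_zero]
        exact_mod_cast hpp.one_lt.ne'
      have e1 : (M.natDegree : ℚ) + 2 * ν = p ^ m := by
        have : M.natDegree + 2 * ν = p ^ m := by omega
        exact_mod_cast this
      have e2 : (p : ℚ) ^ m - 1 = ν * (p - 1) := by
        have : p ^ m = ν * (p - 1) + 1 := by omega
        zify [hp1] at this
        have h3 : ((p : ℚ)) ^ m = ν * (p - 1) + 1 := by exact_mod_cast this
        rw [h3]; ring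
      rw [hML, eq_div_iff hpQ, pow_succ]
      linear_combination (p - 1 : ℚ) * e1 + 2 * e2
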